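/- **Setting.** Let $x=(x^1,x^2,x^3,x^4)$ be the coordinates of $\mathbb R^4$; commas denote partial derivatives, Latin indices run over $1,\dots,4$, Greek indices over $\{3,4\}$, and repeated indices are summed. Let $\mathcal G$ be a finite-dimensional real Lie algebra with a symmetric nondegenerate scalar product "." such that $f.[k,l]=[f,k].l$, and let $V\in C^\infty(\mathbb R)$. Let $L\subset\mathbb R^4$, and let $G=G^1_{T_1}=\{x\in L: x^1=0,\ 0\le x^1+x^2\le T_1\}$ be contained in the closure of its interior relative to the hyperplane $\{x^1=0\}$. On an open neighbourhood of $G$ let $g_{ij}$ (symmetric and nondegenerate, for instance Lorentzian), $A_i$ ($\mathcal G$-valued) and $\Phi$ ($\mathcal G$-valued) be $C^\infty$. Put $$\Gamma^k_{ij}=\tfrac12 g^{km}(g_{mj,i}+g_{mi,j}-g_{ij,m}),\quad \Gamma^k=g^{ij}\Gamma^k_{ij},\quad R_{ij}=\Gamma^k_{ij,k}-\Gamma^k_{ik,j}+\Gamma^k_{kl}\Gamma^l_{ij}-\Gamma^k_{jl}\Gamma^l_{ik},$$ $$F_{ij}=A_{j,i}-A_{i,j}+[A_i,A_j],\quad \widehat\nabla_iF^{ij}=\nabla_iF^{ij}+[A_i,F^{ij}],\quad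 \widehat\nabla_i\Phi=\Phi_{,i}+[A_i,\Phi],\quad J^k=[\Phi,\widehat\nabla^k\Phi],$$ $$\Delta=\nabla_iA^i=g^{ik}(A_{k,i}-\Gamma^l_{ik}A_l),\qquad LA_p=g_{jp}\widehat\nabla_iF^{ij}+\Delta_{,p}+\Gamma^l_{,p}A_l+\Gamma^lA_{l,p},$$ $$\tau_{ij}=F_{ik}.F_j{}^k-\tfrac14g_{ij}F_{kl}.F^{kl}+\widehat\nabla_i\Phi.\widehat\nabla_j\Phi+\tfrac12g_{ij}V(\Phi.\Phi).$$ Assume that on $G$: $g_{22}=g_{23}=g_{24}=0$ and $A_2=0$; $g_{\alpha\beta}=\Omega h_{\alpha\beta}$ with $\det(h_{\alpha\beta})=1$ and a function $\Omega>0$ that is $C^\infty$ near $G$ in $\{x^1=0\}$; $g_{12,2}=\frac12g_{12}\Omega_{,2}/\Omega$; and $g_{22,1}=2g_{12,2}$. (On $G$ one has $g^{12}=1/g_{12}$, and $(g^{\alpha\beta})$ is the inverse of the $2\times2$ matrix $(g_{\alpha\beta})$.) A quantity is called *known* if it is built from the restrictions of $g_{12},g_{\alpha\beta},A_\alpha,\Phi$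 to $\{x^1=0\}$ and their derivatives in $x^2,x^3,x^4$ only; $g_{22,1}=2g_{12,2}$ is known. **Proposition 3.7.** (i) On $G$, for $\alpha\in\{3,4\}$, $$R_{2\alpha}+\tfrac12g_{\alpha\beta}\Gamma^\beta_{,2}+\bigl(g^{12}g_{12,2}g_{\alpha\beta}+\tfrac12g_{\alpha\beta,2}\bigr)\Gamma^\beta = g^{12}g_{1\alpha,22}+(g^{12})^2g_{12,2}g_{1\alpha,2}-g_{\alpha\beta,2}g^{\beta\lambda}g^{12}g_{1\lambda,2}+\chi^{\lambda}_{0\alpha}g_{1\lambda}+c_\alpha,$$ $$LA_2-2\Delta_{,2}-2g^{12}g_{12,2}\Delta-2(g^{12}g_{12,2}A_\nu+A_{\nu,2})\Gamma^\nu-2A_\nu\Gamma^\nu_{,2} = -2g^{12}A_{1,22}-2(g^{12})^2g_{12,2}A_{1,2}+2g^{12}g^{\alpha\lambda}A_{\alpha,2}g_{1\lambda,2}+K^\lambda g_{1\lambda}+A_g,$$ with the known quantities $$\chi^\lambda_{0\alpha}=(g^{12})^2g_{12,2}g_{\alpha\beta}g^{\beta\lambda}_{,2}+\tfrac12\bigl[g_{\alpha\beta}g^{12}g^{\beta\lambda}_{,22}-g^{12}g^{\beta\lambda}g_{\alpha\beta,22}\bigr],$$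 $$\begin{aligned}c_\alpha={}&\tfrac12g^{12}g_{12,2}\bigl[-2g^{12}g_{12,\alpha}+g^{\mu\theta}(2g_{\alpha\mu,\theta}-g_{\mu\theta,\alpha})\bigr]+\tfrac14g_{\alpha\beta,2}B^\beta+\tfrac12(g^{\lambda\beta}g_{\alpha\beta,2})_{,\lambda}-3(g^{12}g_{12,2})_{,\alpha}\\&-\tfrac12(g^{12})^2g_{12,2}g_{12,\alpha}+\tfrac12g^{12}(g_{22,1\alpha}+g_{12,2\alpha})+\tfrac14g^{\beta\lambda}_{,2}g_{\lambda\beta,\alpha}+\tfrac14g_{\alpha\beta,2}g^{\beta\lambda}g^{\mu\theta}g_{\mu\theta,\lambda}+\tfrac14g_{\alpha\beta}B^\beta_{,2},\\B^\beta={}&-2g^{\beta\lambda}g^{12}g_{12,\lambda}+g^{\beta\lambda}g^{\mu\theta}(2g_{\lambda\mu,\theta}-g_{\mu\theta,\lambda}),\end{aligned}$$ $$\begin{aligned}K^\lambda={}&4(g^{12})^2g_{12,2}g^{\alpha\lambda}A_{\alpha,2}+\bigl[2g^{12}g^{\alpha\lambda}g^{\beta\mu}g_{\mu\beta,2}A_\alpha+2g^{12}g^{\alpha\lambda}A_{\alpha,2}\bigr]_{,2}\\&-2(g^{12}g^{\alpha\lambda}A_\alpha)_{,2}\,g^{\beta\mu}g_{\mu\beta,2}-2g^{12}g^{\alpha\lambda}A_\alpha\bigl[g^{\beta\mu}g_{\mu\beta,2}\bigr]_{,2},\end{aligned}$$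 and, with $t_\lambda=g^{\beta\mu}(g_{\mu\lambda,\beta}+g_{\lambda\beta,\mu}-g_{\mu\beta,\lambda})$, $$\begin{aligned}A_g={}&-2(g^{12}g^{\alpha\lambda}A_\alpha)_{,2}g_{12,\lambda}-2g^{12}g^{\alpha\lambda}A_\alpha g_{12,2\lambda}-g^{\beta\alpha}\bigl([A_\beta,A_{\alpha,2}]-g^{12}g_{12,\beta}A_{\alpha,2}\bigr)\\&+(g^{12}g^{\alpha\lambda}A_\alpha)_{,2}\,g_{12}t_\lambda+g^{12}g^{\alpha\lambda}A_\alpha(g_{12}t_\lambda)_{,2}\\&-\bigl\{g^{\alpha\beta}\bigl[g^{12}g_{12,\beta}+\tfrac12g^{\lambda\mu}(g_{\mu\beta,\lambda}+g_{\lambda\mu,\beta}-g_{\beta\lambda,\mu})\bigr]+g^{\alpha\beta}_{,\beta}\bigr\}A_{\alpha,2}\\&+\bigl(2g^{12}g^{\alpha\lambda}g_{12,\lambda}A_\alpha-g^{\alpha\delta}t_\delta A_\alpha\bigr)_{,2}-2g^{\alpha\beta}A_{\alpha,2\beta}-2g^{12}g_{12,2}g^{\alpha\beta}A_{\alpha,\beta}-g^{\alpha\beta}_{,2}A_{\alpha,\beta}.\end{aligned}$$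 (ii) At every point of $G$, the system $$R_{2\alpha}+\tfrac12g_{\alpha\beta}\Gamma^\beta_{,2}+\bigl(g^{12}g_{12,2}g_{\alpha\beta}+\tfrac12g_{\alpha\beta,2}+A_\beta.A_{\alpha,2}\bigr)\Gamma^\beta+A_{\alpha,2}.\Delta=\tau_{2\alpha}\quad(\alpha=3,4),$$ $$LA_2-2\Delta_{,2}-2g^{12}g_{12,2}\Delta-2(g^{12}g_{12,2}A_\nu+A_{\nu,2})\Gamma^\nu-2A_\nu\Gamma^\nu_{,2}=J_2$$ is equivalent to the following linear second-order system of ODEs in $x^2$ for $(A_1,g_{13},g_{14})$, whose coefficients are all known: $$g^{12}g_{1\alpha,22}+\kappa_\alpha^\lambda g_{1\lambda,2}+\varkappa_\alpha.A_{1,2}+\chi_\alpha^\lambda g_{1\lambda}+\digamma_\alpha=0\quad(\alpha=3,4),$$ $$-2g^{12}A_{1,22}-2(g^{12})^2g_{12,2}A_{1,2}+2g^{12}g^{\alpha\lambda}A_{\alpha,2}g_{1\lambda,2}+a^\lambda g_{1\lambda}+b=0,$$ where $$\kappa_\alpha^\lambda=(g^{12})^2g_{12,2}\delta_\alpha^\lambda-g^{12}g_{\alpha\beta,2}g^{\beta\lambda},\quad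 \varkappa_\alpha=2g^{12}A_{\alpha,2},\quad \chi_\alpha^\lambda=\chi_{0\alpha}^\lambda-2g^{\nu\lambda}g^{12}A_{\alpha,2}.A_{\nu,2},\quad a^\lambda=K^\lambda,$$ $$\digamma_\alpha=c_\alpha+g^{\beta\lambda}(A_{\alpha,\lambda}-A_{\lambda,\alpha}+[A_\lambda,A_\alpha]).A_{\beta,2}+g^{\mu\nu}A_{\alpha,2}.A_{\mu,\nu}-\Phi_{,2}.(\Phi_{,\alpha}+[A_\alpha,\Phi]),$$ $$b=A_g-J_2,\qquad J_2=[\Phi,\Phi_{,2}].$$ -/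

import Mathlib

open scoped ContDiff

noncomputable section

namespace EYMH

/-! Coordinates and derivatives. The coordinates `(x¹, x², x³, x⁴)` of `ℝ⁴` carry the indices
`0, 1, 2, 3`, and the coordinates `(x², x³, x⁴)` of the hyperplane `x¹ = 0` carry the indices
`0, 1, 2`. A Greek index `α ∈ {3, 4}` is an element `a : Fin 2`. -/

/-- Coordinate space of dimension `n`. -/
abbrev Sp (n : ℕ) : Type := Fin n → ℝ

/-- The partial derivative of a real function in the `i`-th coordinate. -/
def pd {n : ℕ} (i : Fin n) (f : Sp n → ℝ) : Sp n → ℝ :=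
  fun x => fderiv ℝ f x (Pi.single i 1)

/-- The partial derivative of a function with values in a real vector space with basis `ε`,
taken component by component. -/
def pdL {n N : ℕ} {𝔤 : Type*} [AddCommGroup 𝔤] [Module ℝ 𝔤] (ε : Module.Basis (Fin N) ℝ 𝔤)
    (i : Fin n) (f : Sp n → 𝔤) : Sp n → 𝔤 :=
  fun x => ∑ I, pd i (fun z => ε.repr (f z) I) x • ε I

/-- The Greek index `a`, as an index of the four coordinates: `0 ↦ x³`, `1 ↦ x⁴`. -/
abbrev gk (a : Fin 2) : Fin 4 := a.succ.succ

/-- The Greek index `a`, as an index of the coordinates `(x², x³, x⁴)` of the hyperplane. -/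
abbrev gs (a : Fin 2) : Fin 3 := a.succ

/-- The hyperplane `x¹ = 0`: `(x², x³, x⁴) ↦ (0, x², x³, x⁴)`. -/
def emb (y : Sp 3) : Sp 4 := Fin.cons 0 y

/-- `G¹_T = {x ∈ L : x¹ = 0, 0 ≤ x¹ + x² ≤ T}`. -/
def G1 (L : Set (Sp 4)) (T : ℝ) : Set (Sp 4) :=
  {x | x ∈ L ∧ x 0 = 0 ∧ 0 ≤ x 0 + x 1 ∧ x 0 + x 1 ≤ T}

/-- `G¹_T` in the coordinates `(x², x³, x⁴)` of the hyperplane `x¹ = 0`. -/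
def slice (L : Set (Sp 4)) (T : ℝ) : Set (Sp 3) := {y | emb y ∈ G1 L T}

/-- The components of a metric, of a Yang-Mills potential and of a Higgs field. -/
structure Fields (𝔤 : Type*) where
  g : Fin 4 → Fin 4 → Sp 4 → ℝ
  A : Fin 4 → Sp 4 → 𝔤
  Φ : Sp 4 → 𝔤

/-- The quantities on the hyperplane `x¹ = 0` that are known at the stage under consideration:
`g₁₂`, `g_{αβ}`, `A_α` and `Φ`, as functions of `(x², x³, x⁴)`. -/
structure Known (𝔤 : Type*) where
  g12 : Sp 3 → ℝ
  q : Fin 2 → Fin 2 → Sp 3 → ℝ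
  A : Fin 2 → Sp 3 → 𝔤
  Φ : Sp 3 → 𝔤

section FourDim

namespace Fields

variable {𝔤 : Type*} [LieRing 𝔤] [LieAlgebra ℝ 𝔤] {N : ℕ}

/-- On `U` the components of the fields are `C^∞` and `g` is symmetric and nondegenerate. -/
structure RegularOn (F : Fields 𝔤) (ε : Module.Basis (Fin N) ℝ 𝔤) (U : Set (Sp 4)) : Prop where
  smooth_g : ∀ i j, ContDiffOn ℝ ∞ (F.g i j) U
  smooth_A : ∀ i I, ContDiffOn ℝ ∞ (fun x => ε.repr (F.A i x) I) U
  smooth_Φ : ∀ I, ContDiffOn ℝ ∞ (fun x => ε.repr (F.Φ x) I) U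
  symm : ∀ i j, ∀ x ∈ U, F.g i j x = F.g j i x
  nondeg : ∀ x ∈ U, (Matrix.of fun i j => F.g i j x).det ≠ 0

/-- The inverse metric `g^{ij}`. -/
def gInv (F : Fields 𝔤) (i j : Fin 4) : Sp 4 → ℝ :=
  fun x => (Matrix.of fun k l => F.g k l x)⁻¹ i j

/-- The Christoffel symbols `Γ^k_{ij} = ½ g^{km} (g_{mj,i} + g_{mi,j} - g_{ij,m})`. -/
def chr (F : Fields 𝔤) (k i j : Fin 4) : Sp 4 → ℝ := fun x =>
  (1 / 2) * ∑ m, F.gInv k m x * (pd i (F.g m j) x + pd j (F.g m i) x - pd m (F.g i j) x)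

/-- `Γ^k = g^{ij} Γ^k_{ij}`. -/
def Γ (F : Fields 𝔤) (k : Fin 4) : Sp 4 → ℝ := fun x =>
  ∑ i, ∑ j, F.gInv i j x * F.chr k i j x

/-- The Ricci tensor
`R_{ij} = Γ^k_{ij,k} - Γ^k_{ik,j} + Γ^k_{kl} Γ^l_{ij} - Γ^k_{jl} Γ^l_{ik}`. -/
def ricci (F : Fields 𝔤) (i j : Fin 4) : Sp 4 → ℝ := fun x =>
  ∑ k, (pd k (F.chr k i j) x - pd j (F.chr k i k) x)
    + ∑ k, ∑ l, (F.chr k k l x * F.chr l i j x - F.chr k j l x * F.chr l i k x)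

/-- The Yang-Mills field `F = dA + ½ [A, A]`, that is
`F_{ij} = ∂_i A_j - ∂_j A_i + [A_i, A_j]`. -/
def curv (F : Fields 𝔤) (ε : Module.Basis (Fin N) ℝ 𝔤) (i j : Fin 4) : Sp 4 → 𝔤 := fun x =>
  pdL ε i (F.A j) x - pdL ε j (F.A i) x + ⁅F.A i x, F.A j x⁆

/-- `F^{ij} = g^{ia} g^{jb} F_{ab}`. -/
def curvUp (F : Fields 𝔤) (ε : Module.Basis (Fin N) ℝ 𝔤) (i j : Fin 4) : Sp 4 → 𝔤 := fun x =>
  ∑ a, ∑ b, (F.gInv i a x * F.gInv j b x) • F.curv ε a b x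

/-- The gauge covariant divergence `∇̂_i F^{ij} = ∇_i F^{ij} + [A_i, F^{ij}]`, with
`∇_i F^{ij} = ∂_i F^{ij} + Γ^i_{im} F^{mj} + Γ^j_{im} F^{im}`. -/
def divCurv (F : Fields 𝔤) (ε : Module.Basis (Fin N) ℝ 𝔤) (j : Fin 4) : Sp 4 → 𝔤 := fun x =>
  ∑ i, (pdL ε i (F.curvUp ε i j) x
    + ∑ m, (F.chr i i m x • F.curvUp ε m j x + F.chr j i m x • F.curvUp ε i m x)
    + ⁅F.A i x, F.curvUp ε i j x⁆)

/-- The Lorentz gauge quantity `Δ = ∇_i A^i = g^{ik} (A_{k,i} - Γ^l_{ik} A_l)`. -/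
def Δ (F : Fields 𝔤) (ε : Module.Basis (Fin N) ℝ 𝔤) : Sp 4 → 𝔤 := fun x =>
  ∑ i, ∑ k, F.gInv i k x • (pdL ε i (F.A k) x - ∑ l, F.chr l i k x • F.A l x)

/-- `LA_p = g_{jp} ∇̂_i F^{ij} + (Δ_{,p} + Γ^l_{,p} A_l + Γ^l A_{l,p})`. -/
def LA (F : Fields 𝔤) (ε : Module.Basis (Fin N) ℝ 𝔤) (p : Fin 4) : Sp 4 → 𝔤 := fun x =>
  ∑ j, F.g j p x • F.divCurv ε j x
    + (pdL ε p (F.Δ ε) x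
      + ∑ l, (pd p (F.Γ l) x • F.A l x + F.Γ l x • pdL ε p (F.A l) x))

/-- `∇̂_i Φ = ∂_i Φ + [A_i, Φ]`. -/
def dHiggs (F : Fields 𝔤) (ε : Module.Basis (Fin N) ℝ 𝔤) (i : Fin 4) : Sp 4 → 𝔤 := fun x =>
  pdL ε i F.Φ x + ⁅F.A i x, F.Φ x⁆

/-- The Yang-Mills current `J^k = [Φ, ∇̂^k Φ]`. -/
def currentUp (F : Fields 𝔤) (ε : Module.Basis (Fin N) ℝ 𝔤) (k : Fin 4) : Sp 4 → 𝔤 := fun x =>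
  ⁅F.Φ x, ∑ i, F.gInv k i x • F.dHiggs ε i x⁆

/-- `J_p = g_{pk} J^k`. -/
def J (F : Fields 𝔤) (ε : Module.Basis (Fin N) ℝ 𝔤) (p : Fin 4) : Sp 4 → 𝔤 := fun x =>
  ∑ k, F.g p k x • F.currentUp ε k x

/-- `τ_{ij} = F_{ik}.F_j^k - ¼ g_{ij} F_{kl}.F^{kl} + ∇̂_i Φ.∇̂_j Φ + ½ g_{ij} V(Φ.Φ)`, where
`F_j^k = g^{kl} F_{jl}` and the dot is the scalar product `B`. -/
def τ (F : Fields 𝔤) (ε : Module.Basis (Fin N) ℝ 𝔤) (B : LinearMap.BilinForm ℝ 𝔤) (V : ℝ → ℝ)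
    (i j : Fin 4) : Sp 4 → ℝ := fun x =>
  ∑ k, B (F.curv ε i k x) (∑ l, F.gInv k l x • F.curv ε j l x)
    - (1 / 4) * F.g i j x * ∑ k, ∑ l, B (F.curv ε k l x) (F.curvUp ε k l x)
    + B (F.dHiggs ε i x) (F.dHiggs ε j x)
    + (1 / 2) * F.g i j x * V (B (F.Φ x) (F.Φ x))

/-- The known quantities of the fields on `x¹ = 0`. -/
def known (F : Fields 𝔤) : Known 𝔤 where
  g12 := fun y => F.g 0 1 (emb y)
  q := fun a b y => F.g (gk a) (gk b) (emb y)
  A := fun a y => F.A (gk a) (emb y)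
  Φ := fun y => F.Φ (emb y)

/-- The unknowns `g_{1α}` on `x¹ = 0`. -/
def unkG (F : Fields 𝔤) (a : Fin 2) : Sp 3 → ℝ := fun y => F.g 0 (gk a) (emb y)

/-- The unknown `A₁` on `x¹ = 0`. -/
def unkA (F : Fields 𝔤) : Sp 3 → 𝔤 := fun y => F.A 0 (emb y)

/-- The conditions on `S ⊆ {x¹ = 0}` at the stage under consideration:
`g₂₂ = g₂₃ = g₂₄ = 0` and `A₂ = 0`; `g_{αβ} = Ω h_{αβ}` with `Ω > 0` and `det (h_{αβ}) = 1`;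
`g_{12,2} = ½ g₁₂ Ω_{,2} / Ω`; and `g_{22,1} = 2 g_{12,2}`. -/
structure Stage (F : Fields 𝔤) (S : Set (Sp 3)) (Ω : Sp 3 → ℝ)
    (h : Fin 2 → Fin 2 → Sp 3 → ℝ) : Prop where
  g22 : ∀ y ∈ S, F.g 1 1 (emb y) = 0
  g2a : ∀ a, ∀ y ∈ S, F.g 1 (gk a) (emb y) = 0
  A2 : ∀ y ∈ S, F.A 1 (emb y) = 0
  Ω_pos : ∀ y ∈ S, 0 < Ω y
  det_h : ∀ y ∈ S, (Matrix.of fun a b => h a b y).det = 1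
  conf : ∀ a b, ∀ y ∈ S, F.g (gk a) (gk b) (emb y) = Ω y * h a b y
  g12 : ∀ y ∈ S, pd 1 (F.g 0 1) (emb y) = (1 / 2) * F.g 0 1 (emb y) * (pd 0 Ω y / Ω y)
  g221 : ∀ y ∈ S, pd 0 (F.g 1 1) (emb y) = 2 * pd 1 (F.g 0 1) (emb y)

/-- `R_{2α} + ½ g_{αβ} Γ^β_{,2} + (g^{12} g_{12,2} g_{αβ} + ½ g_{αβ,2}) Γ^β`. -/
def combR (F : Fields 𝔤) (a : Fin 2) : Sp 4 → ℝ := fun x =>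
  F.ricci 1 (gk a) x
    + (1 / 2) * ∑ b, F.g (gk a) (gk b) x * pd 1 (F.Γ (gk b)) x
    + ∑ b, (F.gInv 0 1 x * pd 1 (F.g 0 1) x * F.g (gk a) (gk b) x
        + (1 / 2) * pd 1 (F.g (gk a) (gk b)) x) * F.Γ (gk b) x

/-- `LA₂ - 2 Δ_{,2} - 2 g^{12} g_{12,2} Δ - 2 (g^{12} g_{12,2} A_ν + A_{ν,2}) Γ^ν
- 2 A_ν Γ^ν_{,2}`. -/
def combA (F : Fields 𝔤) (ε : Module.Basis (Fin N) ℝ 𝔤) : Sp 4 → 𝔤 := fun x =>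
  F.LA ε 1 x - (2 : ℝ) • pdL ε 1 (F.Δ ε) x
    - (2 * F.gInv 0 1 x * pd 1 (F.g 0 1) x) • F.Δ ε x
    - (2 : ℝ) • ∑ v, F.Γ (gk v) x • ((F.gInv 0 1 x * pd 1 (F.g 0 1) x) • F.A (gk v) x
        + pdL ε 1 (F.A (gk v)) x)
    - (2 : ℝ) • ∑ v, pd 1 (F.Γ (gk v)) x • F.A (gk v) x

/-- The equations `R_{2α} = τ_{2α}` (`α = 3, 4`) and `LA₂ = J₂`, modified by gauge terms, at the
point `x`:
`R_{2α} + ½ g_{αβ} Γ^β_{,2} + (g^{12} g_{12,2} g_{αβ} + ½ g_{αβ,2} + A_β.A_{α,2}) Γ^β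
+ A_{α,2}.Δ = τ_{2α}` and
`LA₂ - 2 Δ_{,2} - 2 g^{12} g_{12,2} Δ - 2 (g^{12} g_{12,2} A_ν + A_{ν,2}) Γ^ν - 2 A_ν Γ^ν_{,2}
= J₂`. -/
def ModifiedReduced (F : Fields 𝔤) (ε : Module.Basis (Fin N) ℝ 𝔤) (B : LinearMap.BilinForm ℝ 𝔤)
    (V : ℝ → ℝ) (x : Sp 4) : Prop :=
  (∀ a : Fin 2,
    F.combR a x + ∑ b, B (F.A (gk b) x) (pdL ε 1 (F.A (gk a)) x) * F.Γ (gk b) x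
      + B (pdL ε 1 (F.A (gk a)) x) (F.Δ ε x) = F.τ ε B V 1 (gk a) x) ∧
  F.combA ε x = F.J ε 1 x

end Fields

end FourDim

section ThreeDim

namespace Known

variable {𝔤 : Type*} [LieRing 𝔤] [LieAlgebra ℝ 𝔤] {N : ℕ}

/-- `g^{12} = 1 / g₁₂` on `x¹ = 0`. -/
def n (K : Known 𝔤) : Sp 3 → ℝ := fun y => (K.g12 y)⁻¹

/-- `g^{αβ}`: the inverse of the `2 × 2` matrix `(g_{αβ})`. -/
def u (K : Known 𝔤) (a b : Fin 2) : Sp 3 → ℝ := fun y =>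
  (Matrix.of fun c d => K.q c d y)⁻¹ a b

/-- `g_{12,2}`. -/
def g122 (K : Known 𝔤) : Sp 3 → ℝ := pd 0 K.g12

/-- The value `2 g_{12,2}` of `g_{22,1}`. -/
def g221 (K : Known 𝔤) : Sp 3 → ℝ := fun y => 2 * K.g122 y

/-- `g^{μθ} (2 g_{αμ,θ} - g_{μθ,α})`. -/
def s (K : Known 𝔤) (a : Fin 2) : Sp 3 → ℝ := fun y =>
  ∑ m, ∑ t, K.u m t y * (2 * pd (gs t) (K.q a m) y - pd (gs a) (K.q m t) y)

/-- `-2 g^{βλ} g^{12} g_{12,λ} + g^{βλ} g^{μθ} (2 g_{λμ,θ} - g_{μθ,λ})`. -/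
def br (K : Known 𝔤) (b : Fin 2) : Sp 3 → ℝ := fun y =>
  ∑ l, (-2 * K.u b l y * K.n y * pd (gs l) K.g12 y + K.u b l y * K.s l y)

/-- The term `c_α`:
`½ g^{12} g_{12,2} [-2 g^{12} g_{12,α} + g^{μθ} (2 g_{αμ,θ} - g_{μθ,α})]`
`+ ¼ g_{αβ,2} [-2 g^{βλ} g^{12} g_{12,λ} + g^{βλ} g^{μθ} (2 g_{λμ,θ} - g_{μθ,λ})]`
`+ ½ (g^{λβ} g_{αβ,2})_{,λ} - 3 (g^{12} g_{12,2})_{,α} - ½ (g^{12})² g_{12,2} g_{12,α}`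
`+ ½ g^{12} (g_{22,1α} + g_{12,2α}) + ¼ g^{βλ}_{,2} g_{λβ,α}`
`+ ¼ g_{αβ,2} g^{βλ} g^{μθ} g_{μθ,λ}`
`+ ¼ g_{αβ} [-2 g^{βλ} g^{12} g_{12,λ} + g^{βλ} g^{μθ} (2 g_{λμ,θ} - g_{μθ,λ})]_{,2}`. -/
def c (K : Known 𝔤) (a : Fin 2) : Sp 3 → ℝ := fun y =>
  (1 / 2) * K.n y * K.g122 y * (-2 * K.n y * pd (gs a) K.g12 y + K.s a y)
    + (1 / 4) * ∑ b, pd 0 (K.q a b) y * K.br b y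
    + (1 / 2) * ∑ l, ∑ b, pd (gs l) (fun z => K.u l b z * pd 0 (K.q a b) z) y
    - 3 * pd (gs a) (fun z => K.n z * K.g122 z) y
    - (1 / 2) * K.n y ^ 2 * K.g122 y * pd (gs a) K.g12 y
    + (1 / 2) * K.n y * (pd (gs a) K.g221 y + pd (gs a) K.g122 y)
    + (1 / 4) * ∑ b, ∑ l, pd 0 (K.u b l) y * pd (gs a) (K.q l b) y
    + (1 / 4) * ∑ b, ∑ l, ∑ m, ∑ t,
        pd 0 (K.q a b) y * K.u b l y * K.u m t y * pd (gs l) (K.q m t) y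
    + (1 / 4) * ∑ b, K.q a b y * pd 0 (K.br b) y

/-- The coefficient of `g_{1λ}` in the first combination:
`(g^{12})² g_{12,2} g_{αβ} g^{βλ}_{,2}`
`+ ½ [g_{αβ} g^{12} g^{βλ}_{,22} - g^{12} g^{βλ} g_{αβ,22}]`. -/
def χ₀ (K : Known 𝔤) (a l : Fin 2) : Sp 3 → ℝ := fun y =>
  ∑ b, (K.n y ^ 2 * K.g122 y * K.q a b y * pd 0 (K.u b l) y
    + (1 / 2) * (K.q a b y * K.n y * pd 0 (pd 0 (K.u b l)) y
      - K.n y * K.u b l y * pd 0 (pd 0 (K.q a b)) y))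

/-- `g^{βμ} g_{μβ,2}`. -/
def tr2 (K : Known 𝔤) : Sp 3 → ℝ := fun y => ∑ b, ∑ m, K.u b m y * pd 0 (K.q m b) y

/-- `g^{βμ} (g_{μλ,β} + g_{λβ,μ} - g_{μβ,λ})`. -/
def t (K : Known 𝔤) (l : Fin 2) : Sp 3 → ℝ := fun y =>
  ∑ b, ∑ m, K.u b m y *
    (pd (gs b) (K.q m l) y + pd (gs m) (K.q l b) y - pd (gs l) (K.q m b) y)

/-- `g^{12} g^{αλ} A_α`. -/
def w (K : Known 𝔤) (l : Fin 2) : Sp 3 → 𝔤 := fun y => ∑ a, (K.n y * K.u a l y) • K.A a y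

/-- `g^{12} g^{αλ} A_{α,2}`. -/
def w₂ (K : Known 𝔤) (ε : Module.Basis (Fin N) ℝ 𝔤) (l : Fin 2) : Sp 3 → 𝔤 := fun y =>
  ∑ a, (K.n y * K.u a l y) • pdL ε 0 (K.A a) y

/-- The coefficient `K^λ` of `g_{1λ}` in the second combination:
`4 (g^{12})² g_{12,2} g^{αλ} A_{α,2}`
`+ [2 g^{12} g^{αλ} g^{βμ} g_{μβ,2} A_α + 2 g^{12} g^{αλ} A_{α,2}]_{,2}`
`- 2 (g^{12} g^{αλ} A_α)_{,2} g^{βμ} g_{μβ,2} - 2 g^{12} g^{αλ} A_α [g^{βμ} g_{μβ,2}]_{,2}`. -/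
def kA (K : Known 𝔤) (ε : Module.Basis (Fin N) ℝ 𝔤) (l : Fin 2) : Sp 3 → 𝔤 := fun y =>
  (4 * K.n y * K.g122 y) • K.w₂ ε l y
    + pdL ε 0 (fun z => (2 * K.tr2 z) • K.w l z + (2 : ℝ) • K.w₂ ε l z) y
    - (2 * K.tr2 y) • pdL ε 0 (K.w l) y
    - (2 * pd 0 K.tr2 y) • K.w l y

/-- The term `A_g`:
`-2 (g^{12} g^{αλ} A_α)_{,2} g_{12,λ} - 2 g^{12} g^{αλ} A_α g_{12,2λ}`
`- g^{βα} ([A_β, A_{α,2}] - g^{12} g_{12,β} A_{α,2})`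
`+ (g^{12} g^{αλ} A_α)_{,2} g₁₂ [g^{βμ} (g_{μλ,β} + g_{λβ,μ} - g_{μβ,λ})]`
`+ g^{12} g^{αλ} A_α (g₁₂ [g^{βμ} (g_{μλ,β} + g_{λβ,μ} - g_{μβ,λ})])_{,2}`
`- {g^{αβ} [g^{12} g_{12,β} + ½ g^{λμ} (g_{μβ,λ} + g_{λμ,β} - g_{βλ,μ})] + g^{αβ}_{,β}} A_{α,2}`
`+ (2 g^{12} g^{αλ} g_{12,λ} A_α - [g^{αδ} g^{βμ} (g_{μδ,β} + g_{δβ,μ} - g_{μβ,δ})] A_α)_{,2}`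
`- 2 g^{αβ} A_{α,2β} - 2 g^{12} g_{12,2} g^{αβ} A_{α,β} - g^{αβ}_{,2} A_{α,β}`. -/
def aG (K : Known 𝔤) (ε : Module.Basis (Fin N) ℝ 𝔤) : Sp 3 → 𝔤 := fun y =>
  -(∑ l, (2 * pd (gs l) K.g12 y) • pdL ε 0 (K.w l) y)
    - ∑ l, (2 * pd (gs l) K.g122 y) • K.w l y
    - ∑ b, ∑ a, K.u b a y • (⁅K.A b y, pdL ε 0 (K.A a) y⁆
        - (K.n y * pd (gs b) K.g12 y) • pdL ε 0 (K.A a) y)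
    + ∑ l, (K.g12 y * K.t l y) • pdL ε 0 (K.w l) y
    + ∑ l, pd 0 (fun z => K.g12 z * K.t l z) y • K.w l y
    - ∑ a, (∑ b, (K.u a b y * (K.n y * pd (gs b) K.g12 y
        + (1 / 2) * ∑ l, ∑ m, K.u l m y *
          (pd (gs l) (K.q m b) y + pd (gs b) (K.q l m) y - pd (gs m) (K.q b l) y))
        + pd (gs b) (K.u a b) y)) • pdL ε 0 (K.A a) y
    + pdL ε 0 (fun z => ∑ l, (2 * pd (gs l) K.g12 z) • K.w l z
        - ∑ a, (∑ d, K.u a d z * K.t d z) • K.A a z) y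
    - ∑ a, ∑ b, (2 * K.u a b y) • pdL ε (gs b) (pdL ε 0 (K.A a)) y
    - ∑ a, ∑ b, (2 * K.n y * K.g122 y * K.u a b y) • pdL ε (gs b) (K.A a) y
    - ∑ a, ∑ b, pd 0 (K.u a b) y • pdL ε (gs b) (K.A a) y

/-- `J₂ = [Φ, Φ_{,2}]`, the value of the current on `x¹ = 0` where `A₂ = 0`. -/
def j2 (K : Known 𝔤) (ε : Module.Basis (Fin N) ℝ 𝔤) : Sp 3 → 𝔤 := fun y =>
  ⁅K.Φ y, pdL ε 0 K.Φ y⁆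

/-- The right-hand side of the first combination, for the unknowns `z = (g₁₃, g₁₄)`:
`g^{12} g_{1α,22} + (g^{12})² g_{12,2} g_{1α,2} - g_{αβ,2} g^{βλ} g^{12} g_{1λ,2}`
`+ χ₀_α^λ g_{1λ} + c_α`. -/
def rhsR (K : Known 𝔤) (z : Fin 2 → Sp 3 → ℝ) (a : Fin 2) : Sp 3 → ℝ := fun y =>
  K.n y * pd 0 (pd 0 (z a)) y + K.n y ^ 2 * K.g122 y * pd 0 (z a) y
    - ∑ b, ∑ l, pd 0 (K.q a b) y * K.u b l y * K.n y * pd 0 (z l) y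
    + ∑ l, K.χ₀ a l y * z l y + K.c a y

/-- The right-hand side of the second combination, for the unknowns `X = A₁` and
`z = (g₁₃, g₁₄)`:
`-2 g^{12} A_{1,22} - 2 (g^{12})² g_{12,2} A_{1,2} + 2 g^{12} g^{αλ} A_{α,2} g_{1λ,2}`
`+ K^λ g_{1λ} + A_g`. -/
def rhsA (K : Known 𝔤) (ε : Module.Basis (Fin N) ℝ 𝔤) (X : Sp 3 → 𝔤) (z : Fin 2 → Sp 3 → ℝ) :
    Sp 3 → 𝔤 := fun y =>
  -((2 * K.n y) • pdL ε 0 (pdL ε 0 X) y) - (2 * K.n y ^ 2 * K.g122 y) • pdL ε 0 X y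
    + ∑ l, (2 * pd 0 (z l) y) • K.w₂ ε l y
    + ∑ l, z l y • K.kA ε l y + K.aG ε y

/-- `κ_α^λ = (g^{12})² g_{12,2} δ_α^λ - g^{12} g_{αβ,2} g^{βλ}`. -/
def κ (K : Known 𝔤) (a l : Fin 2) : Sp 3 → ℝ := fun y =>
  (if a = l then K.n y ^ 2 * K.g122 y else 0) - ∑ b, K.n y * pd 0 (K.q a b) y * K.u b l y

/-- `ϰ_α = 2 g^{12} A_{α,2}`. -/
def ϰ (K : Known 𝔤) (ε : Module.Basis (Fin N) ℝ 𝔤) (a : Fin 2) : Sp 3 → 𝔤 := fun y =>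
  (2 * K.n y) • pdL ε 0 (K.A a) y

/-- `χ_α^λ`: the coefficient `χ₀_α^λ` minus `2 g^{νλ} g^{12} A_{α,2}.A_{ν,2}`. -/
def χ (K : Known 𝔤) (ε : Module.Basis (Fin N) ℝ 𝔤) (B : LinearMap.BilinForm ℝ 𝔤)
    (a l : Fin 2) : Sp 3 → ℝ := fun y =>
  K.χ₀ a l y
    - 2 * ∑ v, K.u v l y * K.n y * B (pdL ε 0 (K.A a) y) (pdL ε 0 (K.A v) y)

/-- `Ϝ_α = c_α + g^{βλ} (A_{α,λ} - A_{λ,α} + [A_λ, A_α]).A_{β,2} + g^{μν} A_{α,2}.A_{μ,ν}`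
`- Φ_{,2}.(Φ_{,α} + [A_α, Φ])`. -/
def dig (K : Known 𝔤) (ε : Module.Basis (Fin N) ℝ 𝔤) (B : LinearMap.BilinForm ℝ 𝔤)
    (a : Fin 2) : Sp 3 → ℝ := fun y =>
  K.c a y
    + ∑ b, ∑ l, K.u b l y * B (pdL ε (gs l) (K.A a) y - pdL ε (gs a) (K.A l) y
        + ⁅K.A l y, K.A a y⁆) (pdL ε 0 (K.A b) y)
    + ∑ m, ∑ v, K.u m v y * B (pdL ε 0 (K.A a) y) (pdL ε (gs v) (K.A m) y)
    - B (pdL ε 0 K.Φ y) (pdL ε (gs a) K.Φ y + ⁅K.A a y, K.Φ y⁆)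

/-- `b = A_g - J₂`. -/
def bA (K : Known 𝔤) (ε : Module.Basis (Fin N) ℝ 𝔤) : Sp 3 → 𝔤 := fun y =>
  K.aG ε y - K.j2 ε y

/-- The linear second order system of ordinary differential equations in the variable `x²` for
the unknowns `X = A₁` and `z = (g₁₃, g₁₄)`, at the point `y`, with coefficients that are
computed from the known quantities only:
`g^{12} g_{1α,22} + κ_α^λ g_{1λ,2} + ϰ_α.A_{1,2} + χ_α^λ g_{1λ} + Ϝ_α = 0` for `α = 3, 4`, and
`-2 g^{12} A_{1,22} - 2 (g^{12})² g_{12,2} A_{1,2} + 2 g^{12} g^{αλ} A_{α,2} g_{1λ,2}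
+ a^λ g_{1λ} + b = 0` with `a^λ = K^λ`. -/
def LinearODE (K : Known 𝔤) (ε : Module.Basis (Fin N) ℝ 𝔤) (B : LinearMap.BilinForm ℝ 𝔤)
    (X : Sp 3 → 𝔤) (z : Fin 2 → Sp 3 → ℝ) (y : Sp 3) : Prop :=
  (∀ a : Fin 2,
    K.n y * pd 0 (pd 0 (z a)) y + ∑ l, K.κ a l y * pd 0 (z l) y + B (K.ϰ ε a y) (pdL ε 0 X y)
      + ∑ l, K.χ ε B a l y * z l y + K.dig ε B a y = 0) ∧
  -((2 * K.n y) • pdL ε 0 (pdL ε 0 X) y) - (2 * K.n y ^ 2 * K.g122 y) • pdL ε 0 X y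
    + ∑ l, pd 0 (z l) y • ((2 : ℝ) • K.w₂ ε l y)
    + ∑ l, z l y • K.kA ε l y + K.bA ε y = 0

end Known

end ThreeDim

end EYMH

end

/-! Below, n stands for g^{12} = 1/g₁₂. On `S` the row g_{2k} of the metric has the single nonzero
entry g₁₂, so g^{11} = g^{1α} = 0. With g_{22,1} = 2g_{12,2} this gives Γ^k_{22} = 0 and Γ¹_{2α} =
0. These zeros remove from R_{2α} and from ∇̂_iF^{i1} every transverse derivative except the
prescribed g_{22,1} and the two undetermined ones g_{2α,1} and A_{2,1}. The only x¹-derivative of a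
connection coefficient that is left, Γ¹_{2α,1}, reduces to g_{22,1α} and first-order terms
(`CharData.pd_zero_chr`).

The gauge terms are chosen to cancel what remains. Put Y_α = g_{αβ}Γ^β, which contains n g_{2α,1},
and D = Δ + Γ^γA_γ, which contains n A_{2,1}. By the Leibniz rule the first combination is R_{2α} +
½Y_{α,2} + n g_{12,2}Y_α, and the second is g₁₂∇̂_iF^{i1} − D_{,2} − 2n g_{12,2}D. In both, the
undetermined derivative and its x²-derivative drop out, and expanding the rest gives the stated
right-hand sides (`CharData.combR_eq`, `CharData.combA_eq`).

Identities that hold only on `S` may be differentiated in the directions x², x³, x⁴: `S` lies in the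
closure of its interior, and both sides are smooth on the open set `Fields.dom`
(`CharData.pd_eqOn`). Closed formulas on `S` for the connection and the field strength therefore
suffice for all tangential derivatives.

The conformal factor enters only through 4g_{12,2} = g₁₂ g^{αβ}g_{αβ,2}, the logarithmic derivative
of det(g_{αβ}) = Ω² (`Fields.Stage.charData`). It yields Γ¹ = 0 and Γ^β_{2β} = 2n g_{12,2}.

For the equivalence, τ_{2α} contains −n A_{α,2}.(A_{1,2} − A_{2,1}), while the added gauge terms are
A_{α,2}.D, which contains n A_{α,2}.(A_{1,2} + A_{2,1}). In the difference A_{2,1} cancels and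
A_{1,2} doubles, so each equation differs from the corresponding ODE only by rearrangement. -/

noncomputable section

namespace EYMH

/-! ### Partial derivatives and restriction to the hyperplane. -/

section Calculus

variable {n : ℕ} {f g : Sp n → ℝ} {x : Sp n} {U : Set (Sp n)}

lemma pd_const (i : Fin n) (c : ℝ) (x : Sp n) : pd i (fun _ => c) x = 0 := by
  simp [pd]

lemma pd_add (i : Fin n) (hf : DifferentiableAt ℝ f x) (hg : DifferentiableAt ℝ g x) :
    pd i (fun z => f z + g z) x = pd i f x + pd i g x := by
  simp [pd, fderiv_fun_add hf hg]

lemma pd_sub (i : Fin n) (hf : DifferentiableAt ℝ f x) (hg : DifferentiableAt ℝ g x) :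
    pd i (fun z => f z - g z) x = pd i f x - pd i g x := by
  simp [pd, fderiv_fun_sub hf hg]

lemma pd_neg (i : Fin n) : pd i (fun z => -f z) x = -pd i f x := by
  simp [pd, fderiv_fun_neg]

lemma pd_mul (i : Fin n) (hf : DifferentiableAt ℝ f x) (hg : DifferentiableAt ℝ g x) :
    pd i (fun z => f z * g z) x = pd i f x * g x + f x * pd i g x := by
  simp only [pd, fderiv_fun_mul hf hg, add_apply,
    smul_apply, smul_eq_mul]
  ring

lemma pd_sum {ι : Type*} [Fintype ι] (i : Fin n) {f : ι → Sp n → ℝ}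
    (hf : ∀ k, DifferentiableAt ℝ (f k) x) :
    pd i (fun z => ∑ k, f k z) x = ∑ k, pd i (f k) x := by
  simp [pd, fderiv_fun_sum (fun k _ => hf k)]

lemma pd_inv (i : Fin n) (hf : DifferentiableAt ℝ f x) (h0 : f x ≠ 0) :
    pd i (fun z => (f z)⁻¹) x = -(f x)⁻¹ ^ 2 * pd i f x := by
  have h := ((hasDerivAt_inv h0).comp_hasFDerivAt x hf.hasFDerivAt).fderiv
  have h' : (fun z => (f z)⁻¹) = Inv.inv ∘ f := rfl
  simp [pd, h', h]

lemma pd_congr (i : Fin n) (h : f =ᶠ[nhds x] g) : pd i f x = pd i g x := by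
  simp [pd, h.fderiv_eq]

lemma pd_congr_on (i : Fin n) (hU : IsOpen U) (h : Set.EqOn f g U) (hx : x ∈ U) :
    pd i f x = pd i g x :=
  pd_congr i (h.eventuallyEq_of_mem (hU.mem_nhds hx))

lemma ContDiffOn.pd {i : Fin n} (hf : ContDiffOn ℝ ∞ f U) (hU : IsOpen U) :
    ContDiffOn ℝ ∞ (pd i f) U :=
  (hf.fderiv_of_isOpen hU (m := ∞) (by simp)).clm_apply contDiffOn_const

lemma ContDiffOn.diffAt (hf : ContDiffOn ℝ ∞ f U) (hU : IsOpen U) (hx : x ∈ U) :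
    DifferentiableAt ℝ f x :=
  (hf.contDiffAt (hU.mem_nhds hx)).differentiableAt (by simp)

lemma pd_comm (i j : Fin n) (hf : ContDiffOn ℝ ∞ f U) (hU : IsOpen U) (hx : x ∈ U) :
    pd i (pd j f) x = pd j (pd i f) x := by
  have hc : ContDiffAt ℝ ∞ f x := hf.contDiffAt (hU.mem_nhds hx)
  have hd : DifferentiableAt ℝ (fderiv ℝ f) x :=
    (hc.fderiv_right (m := 1) (WithTop.coe_le_coe.2 le_top)).differentiableAt (by simp)
  have key : ∀ i j : Fin n, pd i (pd j f) x =
      fderiv ℝ (fderiv ℝ f) x (Pi.single i 1) (Pi.single j 1) := by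
    intro i j
    have h : pd j f = fun z => fderiv ℝ f z (Pi.single j 1) := rfl
    rw [pd, h, fderiv_clm_apply hd (differentiableAt_const _)]
    simp
  rw [key, key]
  exact (hc.isSymmSndFDerivAt (by
    rw [minSmoothness_of_isRCLikeNormedField]
    exact WithTop.coe_le_coe.2 (le_top : (2 : ℕ∞) ≤ ⊤))) _ _

/-- The hyperplane `x¹ = 0` as the range of a continuous linear map. -/
def embL : Sp 3 →L[ℝ] Sp 4 :=
  ContinuousLinearMap.pi (Fin.cons 0 fun i => ContinuousLinearMap.proj i)

lemma embL_apply (y : Sp 3) : embL y = emb y := by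
  funext i
  refine Fin.cases ?_ (fun j => ?_) i <;> simp [embL, emb]

lemma contDiff_emb : ContDiff ℝ ∞ emb := by
  have : emb = embL := funext fun y => (embL_apply y).symm
  rw [this]
  exact embL.contDiff

lemma pd_comp_emb {f : Sp 4 → ℝ} {y : Sp 3} (i : Fin 3) (hf : DifferentiableAt ℝ f (emb y)) :
    pd i (fun y => f (emb y)) y = pd i.succ f (emb y) := by
  have h1 : (fun y => f (emb y)) = f ∘ embL := funext fun y => by simp [embL_apply]
  have h2 : embL (Pi.single i 1) = Pi.single i.succ (1 : ℝ) := by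
    rw [embL_apply]
    funext j
    refine Fin.cases ?_ (fun j => ?_) j
    · simp [emb, (Fin.succ_ne_zero _).symm]
    · simp [emb, Pi.single_apply]
  rw [← embL_apply] at hf
  simp only [pd, h1]
  rw [fderiv_comp _ hf embL.differentiableAt, embL.fderiv, ContinuousLinearMap.comp_apply, h2,
    embL_apply]

/-- Smooth functions that agree on a set contained in the closure of its interior have the same
first derivatives on that set. -/
lemma pd_eq_of_eqOn {S : Set (Sp n)} (hU : IsOpen U) (hSU : S ⊆ U)
    (hS : S ⊆ closure (interior S)) (hf : ContDiffOn ℝ ∞ f U) (hg : ContDiffOn ℝ ∞ g U)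
    (h : Set.EqOn f g S) (i : Fin n) : Set.EqOn (pd i f) (pd i g) S := by
  have h1 : Set.EqOn (pd i f) (pd i g) (interior S) := fun x hx =>
    pd_congr_on i isOpen_interior (h.mono interior_subset) hx
  exact h1.of_subset_closure ((ContDiffOn.pd hf hU).continuousOn.mono hSU)
    ((ContDiffOn.pd hg hU).continuousOn.mono hSU) interior_subset hS

end Calculus

/-! ### Lie-algebra valued functions in components. -/

section LieValued

variable {n N : ℕ} {𝔤 : Type*} [LieRing 𝔤] [LieAlgebra ℝ 𝔤] (ε : Module.Basis (Fin N) ℝ 𝔤)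

lemma repr_pdL (i : Fin n) (f : Sp n → 𝔤) (x : Sp n) (I : Fin N) :
    ε.repr (pdL ε i f x) I = pd i (fun z => ε.repr (f z) I) x := by
  simp only [pdL, Module.Basis.repr_sum_self]

/-- Bilinearity and the structure constants of the basis turn the bracket into a polynomial in
components, so smoothness can be checked without a topology on `𝔤`. -/
lemma repr_lie (a b : 𝔤) (I : Fin N) :
    ε.repr ⁅a, b⁆ I = ∑ J, ∑ K, ε.repr a J * ε.repr b K * ε.repr ⁅ε J, ε K⁆ I := by
  conv_lhs => rw [← ε.sum_repr a, ← ε.sum_repr b]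
  simp only [sum_lie, lie_sum, smul_lie, lie_smul, map_sum, map_smul, Finsupp.coe_finsetSum,
    Finset.sum_apply, Finsupp.smul_apply, smul_eq_mul, Finset.smul_sum, mul_assoc]
  rw [Finset.sum_comm]
  exact Finset.sum_congr rfl fun J _ => Finset.sum_congr rfl fun K _ => by ring

lemma ext_repr {a b : 𝔤} (h : ∀ I, ε.repr a I = ε.repr b I) : a = b :=
  ε.repr.injective (Finsupp.ext h)

/-- Exchanging the two indices shows that the sum equals its own negative. It removes the term
Γ¹_{im}F^{im} from the divergence. -/
lemma sum_smul_eq_zero {ι : Type*} [Fintype ι] {V : Type*} [AddCommGroup V] [Module ℝ V]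
    (c : ι → ι → ℝ) (T : ι → ι → V) (hc : ∀ i j, c i j = c j i) (hT : ∀ i j, T i j = -T j i) :
    ∑ i, ∑ j, c i j • T i j = 0 := by
  set s := ∑ i, ∑ j, c i j • T i j with hs
  have h : s = -s := by
    rw [hs, ← Finset.sum_neg_distrib, Finset.sum_comm]
    refine Finset.sum_congr rfl fun i _ => ?_
    rw [← Finset.sum_neg_distrib]
    refine Finset.sum_congr rfl fun j _ => ?_
    rw [hc j i, hT j i, smul_neg]
  have h2 : (2 : ℝ) • s = 0 := by
    rw [two_smul]
    nth_rewrite 2 [h]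
    exact add_neg_cancel s
  simpa using h2

end LieValued

/-! ### Smoothness of inverse matrices. -/

section InverseMatrix

variable {n k : ℕ} {U : Set (Sp n)} {M : Fin k → Fin k → Sp n → ℝ}

lemma contDiffOn_det (hM : ∀ i j, ContDiffOn ℝ ∞ (M i j) U) :
    ContDiffOn ℝ ∞ (fun x => (Matrix.of fun i j => M i j x).det) U := by
  simp only [Matrix.det_apply, Matrix.of_apply]
  exact ContDiffOn.sum fun σ _ => (contDiffOn_prod fun i _ => hM _ _).const_smul _

lemma contDiffOn_inv (hM : ∀ i j, ContDiffOn ℝ ∞ (M i j) U)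
    (h0 : ∀ x ∈ U, (Matrix.of fun i j => M i j x).det ≠ 0) (a b : Fin k) :
    ContDiffOn ℝ ∞ (fun x => (Matrix.of fun i j => M i j x)⁻¹ a b) U := by
  -- An entry of the adjugate is the determinant of the matrix with row `b` replaced by a unit
  -- vector, hence polynomial in the entries.
  have hadj : ContDiffOn ℝ ∞ (fun x => (Matrix.of fun i j => M i j x).adjugate a b) U := by
    have : (fun x => (Matrix.of fun i j => M i j x).adjugate a b) =
        fun x => (Matrix.of fun i j => (fun z : Sp n =>
          if i = b then (Pi.single a 1 : Fin k → ℝ) j else M i j z) x).det := by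
      funext x
      rw [Matrix.adjugate_apply]
      congr 1
      ext i j
      by_cases h : i = b
      · subst h; simp
      · simp [h]
    rw [this]
    refine contDiffOn_det fun i j => ?_
    by_cases h : i = b
    · simpa only [h, if_true] using contDiffOn_const
    · simpa only [h, if_false] using hM i j
  refine (((contDiffOn_det hM).inv h0).mul hadj).congr fun x _ => ?_
  simp [Matrix.inv_def, Ring.inverse_eq_inv']

end InverseMatrix

/-- The characteristic hyperplane data on a set `S` of the plane `x¹ = 0`: `g₂₂ = g₂₃ = g₂₄ = 0`
and `A₂ = 0`, with `(g_{αβ})` nondegenerate, `4 g_{12,2} = g₁₂ g^{αβ} g_{αβ,2}` and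
`g_{22,1} = 2 g_{12,2}`. -/
structure CharData {𝔤 : Type*} [LieRing 𝔤] [LieAlgebra ℝ 𝔤] {N : ℕ} (F : Fields 𝔤)
    (ε : Module.Basis (Fin N) ℝ 𝔤) (U : Set (Sp 4)) (S : Set (Sp 3)) : Prop where
  isOpen : IsOpen U
  reg : F.RegularOn ε U
  sub : ∀ y ∈ S, emb y ∈ U
  dense : S ⊆ closure (interior S)
  g11 : ∀ y ∈ S, F.g 1 1 (emb y) = 0
  g1a : ∀ a, ∀ y ∈ S, F.g 1 (gk a) (emb y) = 0
  A1 : ∀ y ∈ S, F.A 1 (emb y) = 0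
  det_q : ∀ y ∈ S, (Matrix.of fun a b => F.known.q a b y).det ≠ 0
  g122 : ∀ y ∈ S, 4 * F.known.g122 y = F.known.g12 y * F.known.tr2 y
  g110 : ∀ y ∈ S, pd 0 (F.g 1 1) (emb y) = 2 * pd 1 (F.g 0 1) (emb y)

/-! ### Smoothness of the connection, the field strength and the gauge quantities. -/

namespace Fields

variable {𝔤 : Type*} [LieRing 𝔤] [LieAlgebra ℝ 𝔤] {N : ℕ}

lemma RegularOn.contDiffOn_gInv {F : Fields 𝔤} {ε : Module.Basis (Fin N) ℝ 𝔤} {U : Set (Sp 4)}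
    (hF : F.RegularOn ε U) (i j : Fin 4) : ContDiffOn ℝ ∞ (F.gInv i j) U :=
  contDiffOn_inv hF.smooth_g hF.nondeg i j

lemma RegularOn.contDiffOn_chr {F : Fields 𝔤} {ε : Module.Basis (Fin N) ℝ 𝔤} {U : Set (Sp 4)}
    (hF : F.RegularOn ε U) (hU : IsOpen U) (k i j : Fin 4) : ContDiffOn ℝ ∞ (F.chr k i j) U := by
  have hg := fun i j k => ContDiffOn.pd (i := k) (hF.smooth_g i j) hU
  have hI := hF.contDiffOn_gInv
  unfold Fields.chr
  fun_prop

lemma RegularOn.contDiffOn_Γ {F : Fields 𝔤} {ε : Module.Basis (Fin N) ℝ 𝔤} {U : Set (Sp 4)}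
    (hF : F.RegularOn ε U) (hU : IsOpen U) (k : Fin 4) : ContDiffOn ℝ ∞ (F.Γ k) U := by
  have hI := hF.contDiffOn_gInv
  have hc := hF.contDiffOn_chr hU
  unfold Fields.Γ
  fun_prop

lemma RegularOn.contDiffOn_curv {F : Fields 𝔤} {ε : Module.Basis (Fin N) ℝ 𝔤} {U : Set (Sp 4)}
    (hF : F.RegularOn ε U) (hU : IsOpen U) (i j : Fin 4) (I : Fin N) :
    ContDiffOn ℝ ∞ (fun x => ε.repr (F.curv ε i j x) I) U := by
  have hA := hF.smooth_A
  have hdA := fun i I k => ContDiffOn.pd (i := k) (hF.smooth_A i I) hU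
  simp only [Fields.curv, map_add, map_sub, Finsupp.add_apply, Finsupp.sub_apply, repr_pdL,
    repr_lie ε (F.A i _)]
  fun_prop

lemma RegularOn.contDiffOn_curvUp {F : Fields 𝔤} {ε : Module.Basis (Fin N) ℝ 𝔤} {U : Set (Sp 4)}
    (hF : F.RegularOn ε U) (hU : IsOpen U) (i j : Fin 4) (I : Fin N) :
    ContDiffOn ℝ ∞ (fun x => ε.repr (F.curvUp ε i j x) I) U := by
  have hI := hF.contDiffOn_gInv
  have hc := hF.contDiffOn_curv hU
  simp only [Fields.curvUp, map_sum, map_smul, Finsupp.coe_finsetSum, Finset.sum_apply,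
    Finsupp.smul_apply, smul_eq_mul]
  fun_prop

lemma RegularOn.contDiffOn_Δ {F : Fields 𝔤} {ε : Module.Basis (Fin N) ℝ 𝔤} {U : Set (Sp 4)}
    (hF : F.RegularOn ε U) (hU : IsOpen U) (I : Fin N) :
    ContDiffOn ℝ ∞ (fun x => ε.repr (F.Δ ε x) I) U := by
  have hI := hF.contDiffOn_gInv
  have hc := hF.contDiffOn_chr hU
  have hA := hF.smooth_A
  have hdA := fun i I k => ContDiffOn.pd (i := k) (hF.smooth_A i I) hU
  simp only [Fields.Δ, map_sum, map_sub, map_smul, Finsupp.coe_finsetSum, Finset.sum_apply,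
    Finsupp.smul_apply, Finsupp.sub_apply, smul_eq_mul, repr_pdL]
  fun_prop

/-- The part of the hyperplane `x¹ = 0` inside `U` on which `g₁₂` and `det (g_{αβ})` do not
vanish. -/
def dom (F : Fields 𝔤) (U : Set (Sp 4)) : Set (Sp 3) :=
  {y | emb y ∈ U ∧ F.known.g12 y ≠ 0 ∧ (Matrix.of fun a b => F.known.q a b y).det ≠ 0}

/-- `g_{2α,1}` on `x¹ = 0`. -/
def sG (F : Fields 𝔤) (a : Fin 2) : Sp 3 → ℝ := fun y => pd 0 (F.g 1 (gk a)) (emb y)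

/-- The components of `A_{2,1}` on `x¹ = 0`. -/
def sA (F : Fields 𝔤) (ε : Module.Basis (Fin N) ℝ 𝔤) (I : Fin N) : Sp 3 → ℝ := fun y =>
  pd 0 (fun x => ε.repr (F.A 1 x) I) (emb y)

end Fields

lemma contDiffOn_comp_emb {𝔤 : Type*} {F : Fields 𝔤} {U : Set (Sp 4)} {f : Sp 4 → ℝ}
    (hf : ContDiffOn ℝ ∞ f U) : ContDiffOn ℝ ∞ (fun y => f (emb y)) (F.dom U) :=
  hf.comp contDiff_emb.contDiffOn fun _ hy => hy.1

section

variable {𝔤 : Type*} {F : Fields 𝔤} {U : Set (Sp 4)}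

lemma q_mul_u (a b : Fin 2) {y : Sp 3} (hy : y ∈ F.dom U) :
    ∑ c, F.known.q a c y * F.known.u c b y = if a = b then 1 else 0 := by
  have h := congrFun (congrFun (Matrix.mul_nonsing_inv (Matrix.of fun c d => F.known.q c d y)
    (isUnit_iff_ne_zero.mpr hy.2.2)) a) b
  rw [Matrix.mul_apply, Matrix.one_apply] at h
  exact h

lemma u_mul_q (a b : Fin 2) {y : Sp 3} (hy : y ∈ F.dom U) :
    ∑ c, F.known.u a c y * F.known.q c b y = if a = b then 1 else 0 := by
  have h := congrFun (congrFun (Matrix.nonsing_inv_mul (Matrix.of fun c d => F.known.q c d y)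
    (isUnit_iff_ne_zero.mpr hy.2.2)) a) b
  rw [Matrix.mul_apply, Matrix.one_apply] at h
  exact h

lemma n_mul_g12 {y : Sp 3} (hy : y ∈ F.dom U) : F.known.n y * F.known.g12 y = 1 :=
  inv_mul_cancel₀ hy.2.1

end

/-! ### Smooth known data and tangential differentiation on `S`. -/

namespace CharData

variable {𝔤 : Type*} [LieRing 𝔤] [LieAlgebra ℝ 𝔤] {N : ℕ} {F : Fields 𝔤}
  {ε : Module.Basis (Fin N) ℝ 𝔤} {U : Set (Sp 4)} {S : Set (Sp 3)}

lemma isOpen_dom (D : CharData F ε U S) : IsOpen (F.dom U) := by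
  have hV : IsOpen (emb ⁻¹' U) := D.isOpen.preimage contDiff_emb.continuous
  have hc : ∀ i j, ContDiffOn ℝ ∞ (fun y => F.g i j (emb y)) (emb ⁻¹' U) := fun i j =>
    (D.reg.smooth_g i j).comp contDiff_emb.contDiffOn fun _ hy => hy
  have h1 := (hc 0 1).continuousOn.isOpen_inter_preimage hV isOpen_ne (t := {t : ℝ | t ≠ 0})
  have h2 := (contDiffOn_det (M := F.known.q)
    fun a b => hc (gk a) (gk b)).continuousOn.isOpen_inter_preimage hV (t := {t : ℝ | t ≠ 0})
      isOpen_ne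
  have h : F.dom U = (emb ⁻¹' U ∩ (fun y => F.g 0 1 (emb y)) ⁻¹' {t | t ≠ 0}) ∩
      (emb ⁻¹' U ∩ (fun y => (Matrix.of fun a b => F.known.q a b y).det) ⁻¹' {t | t ≠ 0}) :=
    Set.ext fun y => ⟨fun h => ⟨⟨h.1, h.2.1⟩, h.1, h.2.2⟩, fun h => ⟨h.1.1, h.1.2, h.2.2⟩⟩
  rw [h]
  exact h1.inter h2

lemma symm (D : CharData F ε U S) {y : Sp 3} (hy : y ∈ S) (i j : Fin 4) :
    F.g i j (emb y) = F.g j i (emb y) := D.reg.symm i j _ (D.sub y hy)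

/-- If g₁₂ vanished, a whole row of the metric would vanish, against nondegeneracy. -/
lemma g12_ne (D : CharData F ε U S) {y : Sp 3} (hy : y ∈ S) : F.known.g12 y ≠ 0 := by
  intro h
  refine D.reg.nondeg _ (D.sub y hy) (Matrix.det_eq_zero_of_row_eq_zero 1 fun j => ?_)
  fin_cases j
  · exact (D.symm hy 1 0).trans h
  · exact D.g11 y hy
  · exact D.g1a 0 y hy
  · exact D.g1a 1 y hy

lemma subset_dom (D : CharData F ε U S) : S ⊆ F.dom U := fun y hy =>
  ⟨D.sub y hy, D.g12_ne hy, D.det_q y hy⟩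

lemma smooth_g12 (D : CharData F ε U S) : ContDiffOn ℝ ∞ F.known.g12 (F.dom U) :=
  contDiffOn_comp_emb (D.reg.smooth_g 0 1)

lemma smooth_q (D : CharData F ε U S) (a b : Fin 2) :
    ContDiffOn ℝ ∞ (F.known.q a b) (F.dom U) :=
  contDiffOn_comp_emb (D.reg.smooth_g _ _)

lemma smooth_n (D : CharData F ε U S) : ContDiffOn ℝ ∞ F.known.n (F.dom U) :=
  D.smooth_g12.inv fun _ hy => hy.2.1

lemma smooth_u (D : CharData F ε U S) (a b : Fin 2) : ContDiffOn ℝ ∞ (F.known.u a b) (F.dom U) :=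
  contDiffOn_inv D.smooth_q (fun _ hy => hy.2.2) a b

lemma smooth_z (D : CharData F ε U S) (a : Fin 2) : ContDiffOn ℝ ∞ (F.unkG a) (F.dom U) :=
  contDiffOn_comp_emb (D.reg.smooth_g _ _)

lemma smooth_sG (D : CharData F ε U S) (a : Fin 2) : ContDiffOn ℝ ∞ (F.sG a) (F.dom U) :=
  contDiffOn_comp_emb (ContDiffOn.pd (D.reg.smooth_g _ _) D.isOpen)

lemma smooth_A (D : CharData F ε U S) (a : Fin 2) (I : Fin N) :
    ContDiffOn ℝ ∞ (fun y => ε.repr (F.known.A a y) I) (F.dom U) :=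
  contDiffOn_comp_emb (D.reg.smooth_A _ _)

lemma smooth_unkA (D : CharData F ε U S) (I : Fin N) :
    ContDiffOn ℝ ∞ (fun y => ε.repr (F.unkA y) I) (F.dom U) :=
  contDiffOn_comp_emb (D.reg.smooth_A _ _)

lemma smooth_sA (D : CharData F ε U S) (I : Fin N) : ContDiffOn ℝ ∞ (F.sA ε I) (F.dom U) :=
  contDiffOn_comp_emb (ContDiffOn.pd (D.reg.smooth_A _ _) D.isOpen)

lemma pd_dom (D : CharData F ε U S) {f : Sp 3 → ℝ} (hf : ContDiffOn ℝ ∞ f (F.dom U))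
    (i : Fin 3) : ContDiffOn ℝ ∞ (pd i f) (F.dom U) := ContDiffOn.pd hf D.isOpen_dom

/-- Smooth functions that agree on `S` have the same first derivatives there. -/
lemma pd_eqOn (D : CharData F ε U S) {f g : Sp 3 → ℝ} (hf : ContDiffOn ℝ ∞ f (F.dom U))
    (hg : ContDiffOn ℝ ∞ g (F.dom U)) (h : ∀ y ∈ S, f y = g y) {y : Sp 3} (hy : y ∈ S)
    (i : Fin 3) : pd i f y = pd i g y :=
  pd_eq_of_eqOn D.isOpen_dom D.subset_dom D.dense hf hg h i hy

/-- The tangential derivatives on `S` of a function whose values on `S` are known. -/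
lemma pd_succ (D : CharData F ε U S) {f : Sp 4 → ℝ} {g : Sp 3 → ℝ} (hf : ContDiffOn ℝ ∞ f U)
    (hg : ContDiffOn ℝ ∞ g (F.dom U)) (h : ∀ y ∈ S, f (emb y) = g y) {y : Sp 3} (hy : y ∈ S)
    (i : Fin 3) : pd i.succ f (emb y) = pd i g y := by
  rw [← pd_comp_emb i (ContDiffOn.diffAt hf D.isOpen (D.sub y hy))]
  exact D.pd_eqOn (contDiffOn_comp_emb hf) hg h hy i

lemma pd_succ_eq (D : CharData F ε U S) {f : Sp 4 → ℝ} (hf : ContDiffOn ℝ ∞ f U)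
    {y : Sp 3} (hy : y ∈ S) (i : Fin 3) : pd i.succ f (emb y) = pd i (fun z => f (emb z)) y :=
  (pd_comp_emb i (ContDiffOn.diffAt hf D.isOpen (D.sub y hy))).symm

lemma q_symm (D : CharData F ε U S) (a b : Fin 2) {y : Sp 3} (hy : y ∈ F.dom U) :
    F.known.q a b y = F.known.q b a y := D.reg.symm _ _ _ hy.1

lemma u_symm (D : CharData F ε U S) (a b : Fin 2) {y : Sp 3} (hy : y ∈ F.dom U) :
    F.known.u a b y = F.known.u b a y := by
  have h : (Matrix.of fun c d => F.known.q c d y).transpose =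
      Matrix.of fun c d => F.known.q c d y := by
    ext c d
    exact D.q_symm d c hy
  have := congrFun (congrFun
    (Matrix.transpose_nonsing_inv (Matrix.of fun c d => F.known.q c d y)) b) a
  rw [h] at this
  exact this

lemma pd_q_symm (D : CharData F ε U S) (i : Fin 3) (a b : Fin 2) {y : Sp 3} (hy : y ∈ F.dom U) :
    pd i (F.known.q a b) y = pd i (F.known.q b a) y :=
  pd_congr_on i D.isOpen_dom (fun _ hz => D.q_symm a b hz) hy

lemma pd_pd_q_symm (D : CharData F ε U S) (i j : Fin 3) (a b : Fin 2) {y : Sp 3}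
    (hy : y ∈ F.dom U) : pd j (pd i (F.known.q a b)) y = pd j (pd i (F.known.q b a)) y :=
  pd_congr_on j D.isOpen_dom (fun _ hz => D.pd_q_symm i a b hz) hy

lemma pd_n (D : CharData F ε U S) (i : Fin 3) {y : Sp 3} (hy : y ∈ F.dom U) :
    pd i F.known.n y = -F.known.n y ^ 2 * pd i F.known.g12 y :=
  pd_inv i (ContDiffOn.diffAt D.smooth_g12 D.isOpen_dom hy) hy.2.1

lemma pd_u (D : CharData F ε U S) (i : Fin 3) (a b : Fin 2) {y : Sp 3} (hy : y ∈ F.dom U) :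
    pd i (F.known.u a b) y =
      -∑ c, ∑ d, F.known.u a c y * pd i (F.known.q c d) y * F.known.u d b y := by
  have hu := fun a b => ContDiffOn.diffAt (D.smooth_u a b) D.isOpen_dom hy
  have hq := fun a b => ContDiffOn.diffAt (D.smooth_q a b) D.isOpen_dom hy
  have h : ∀ d, ∑ c, (pd i (F.known.u a c) y * F.known.q c d y
      + F.known.u a c y * pd i (F.known.q c d) y) = 0 := by
    intro d
    have h1 := pd_congr_on (f := fun y => ∑ c, F.known.u a c y * F.known.q c d y) i D.isOpen_dom
      (fun z hz => u_mul_q a d hz) hy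
    rw [pd_const, pd_sum (f := fun c y => F.known.u a c y * F.known.q c d y) i
      fun c => (hu a c).mul (hq c d)] at h1
    rw [← h1]
    exact Finset.sum_congr rfl fun c _ => (pd_mul i (hu a c) (hq c d)).symm
  have h0 := h 0
  have h1 := h 1
  have e0 := q_mul_u 0 b hy
  have e1 := q_mul_u 1 b hy
  simp only [Fin.sum_univ_two] at *
  -- Kronecker deltas keep the free index symbolic, so the deltas in `e0` and `e1` match inside a
  -- linear combination without a case split. The same device recurs below.
  have key : pd i (F.known.u a b) y = pd i (F.known.u a 0) y * (if (0 : Fin 2) = b then 1 else 0)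
      + pd i (F.known.u a 1) y * (if (1 : Fin 2) = b then 1 else 0) := by
    fin_cases b <;> simp
  rw [key]
  linear_combination F.known.u 0 b y * h0 + F.known.u 1 b y * h1
    - pd i (F.known.u a 0) y * e0 - pd i (F.known.u a 1) y * e1

end CharData

/-! ### The inverse metric and the first derivatives of the metric on `S`. -/

namespace CharData

variable {𝔤 : Type*} [LieRing 𝔤] [LieAlgebra ℝ 𝔤] {N : ℕ} {F : Fields 𝔤}
  {ε : Module.Basis (Fin N) ℝ 𝔤} {U : Set (Sp 4)} {S : Set (Sp 3)} {y : Sp 3}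

lemma gInv_symm (D : CharData F ε U S) {x : Sp 4} (hx : x ∈ U) (i j : Fin 4) :
    F.gInv i j x = F.gInv j i x := by
  have h : (Matrix.of fun k l => F.g k l x).transpose = Matrix.of fun k l => F.g k l x := by
    ext k l
    exact D.reg.symm l k x hx
  have := congrFun (congrFun (Matrix.transpose_nonsing_inv (Matrix.of fun k l => F.g k l x)) j) i
  rw [h] at this
  exact this

lemma g_mul_gInv (D : CharData F ε U S) {x : Sp 4} (hx : x ∈ U) (i k : Fin 4) :
    ∑ j, F.g i j x * F.gInv j k x = if i = k then 1 else 0 := by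
  have h := congrFun (congrFun (Matrix.mul_nonsing_inv (Matrix.of fun k l => F.g k l x)
    (isUnit_iff_ne_zero.mpr (D.reg.nondeg x hx))) i) k
  rw [Matrix.mul_apply, Matrix.one_apply] at h
  exact h

/-- Since g₁₂ is the only nonzero entry g_{2j}, the relation g_{2j}g^{jk} = δ₂^k reads g₁₂g^{1k} =
δ₂^k. -/
lemma gInv_zero (D : CharData F ε U S) (hy : y ∈ S) (k : Fin 4) :
    F.gInv 0 k (emb y) = if k = 1 then F.known.n y else 0 := by
  have h := D.g_mul_gInv (D.sub y hy) 1 k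
  have hn : F.known.n y * F.known.g12 y = 1 := n_mul_g12 (D.subset_dom hy)
  have h2 : F.g 1 2 (emb y) = 0 := D.g1a 0 y hy
  have h3 : F.g 1 3 (emb y) = 0 := D.g1a 1 y hy
  have h0 : F.g 1 0 (emb y) = F.known.g12 y := D.symm hy 1 0
  rw [Fin.sum_univ_four, D.g11 y hy, h0, h2, h3] at h
  have h' : F.known.n y * (F.known.g12 y * F.gInv 0 k (emb y)) = F.gInv 0 k (emb y) := by
    rw [← mul_assoc, hn, one_mul]
  rw [← h']
  simp only [zero_mul, add_zero] at h
  rw [h]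
  by_cases hk : k = 1
  · simp [hk]
  · simp [hk, Ne.symm hk]

/-- The relation g_{αj}g^{jk} = δ_α^k reads g_{1α}g^{1k} + g_{αβ}g^{βk} = δ_α^k, and is solved with
the inverse of (g_{αβ}). No formula for g^{22} is needed: it only multiplies quantities that vanish
on `S`. -/
lemma gInv_gk (D : CharData F ε U S) (hy : y ∈ S) (b : Fin 2) (k : Fin 4) :
    F.gInv (gk b) k (emb y) = ∑ a, F.known.u b a y *
      ((if gk a = k then 1 else 0) - F.unkG a y * F.gInv 0 k (emb y)) := by
  have h := fun a : Fin 2 => D.g_mul_gInv (D.sub y hy) (gk a) k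
  have hs : ∀ a : Fin 2, F.g (gk a) 0 (emb y) = F.unkG a y := fun a => D.symm hy _ _
  have hs' : ∀ a : Fin 2, F.g (gk a) 1 (emb y) = 0 := fun a =>
    (D.symm hy _ _).trans (D.g1a a y hy)
  have h2 : ∀ a : Fin 2, F.g (gk a) 2 (emb y) = F.known.q a 0 y := fun a => rfl
  have h3 : ∀ a : Fin 2, F.g (gk a) 3 (emb y) = F.known.q a 1 y := fun a => rfl
  simp only [Fin.sum_univ_four, hs, hs', h2, h3] at h
  have e0 := u_mul_q b 0 (D.subset_dom hy)
  have e1 := u_mul_q b 1 (D.subset_dom hy)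
  have k0 := h 0
  have k1 := h 1
  simp only [Fin.sum_univ_two] at *
  rw [← k0, ← k1]
  have key : F.gInv (gk b) k (emb y) = (if b = 0 then 1 else 0) * F.gInv 2 k (emb y)
      + (if b = 1 then 1 else 0) * F.gInv 3 k (emb y) := by
    fin_cases b <;> simp <;> rfl
  rw [key, ← e0, ← e1]
  ring

lemma gInv_zero_zero (D : CharData F ε U S) (hy : y ∈ S) : F.gInv 0 0 (emb y) = 0 := by
  simp [D.gInv_zero hy]

lemma gInv_zero_one (D : CharData F ε U S) (hy : y ∈ S) :
    F.gInv 0 1 (emb y) = F.known.n y := by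
  simp [D.gInv_zero hy]

lemma gInv_one_zero (D : CharData F ε U S) (hy : y ∈ S) :
    F.gInv 1 0 (emb y) = F.known.n y := by
  rw [D.gInv_symm (D.sub y hy), D.gInv_zero_one hy]

lemma gInv_zero_gk (D : CharData F ε U S) (hy : y ∈ S) (a : Fin 2) :
    F.gInv 0 (gk a) (emb y) = 0 := by
  rw [D.gInv_zero hy, if_neg (by fin_cases a <;> decide)]

lemma gInv_gk_zero (D : CharData F ε U S) (hy : y ∈ S) (a : Fin 2) :
    F.gInv (gk a) 0 (emb y) = 0 := by
  rw [D.gInv_symm (D.sub y hy), D.gInv_zero_gk hy]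

lemma gInv_gk_one (D : CharData F ε U S) (hy : y ∈ S) (a : Fin 2) :
    F.gInv (gk a) 1 (emb y) = -F.known.n y * ∑ b, F.known.u a b y * F.unkG b y := by
  rw [D.gInv_gk hy, D.gInv_zero_one hy]
  simp only [Fin.sum_univ_two]
  rw [if_neg (by decide), if_neg (by decide)]
  ring

lemma gInv_one_gk (D : CharData F ε U S) (hy : y ∈ S) (a : Fin 2) :
    F.gInv 1 (gk a) (emb y) = -F.known.n y * ∑ b, F.known.u a b y * F.unkG b y := by
  rw [D.gInv_symm (D.sub y hy), D.gInv_gk_one hy]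

lemma gInv_gk_gk (D : CharData F ε U S) (hy : y ∈ S) (a b : Fin 2) :
    F.gInv (gk a) (gk b) (emb y) = F.known.u a b y := by
  rw [D.gInv_gk hy, D.gInv_zero_gk hy]
  fin_cases b <;> simp

lemma chr_symm (D : CharData F ε U S) {x : Sp 4} (hx : x ∈ U) (k i j : Fin 4) :
    F.chr k i j x = F.chr k j i x := by
  simp only [Fields.chr]
  congr 1
  refine Finset.sum_congr rfl fun m _ => ?_
  rw [pd_congr_on m D.isOpen (fun z hz => D.reg.symm i j z hz) hx]
  ring

lemma pd_g_symm (D : CharData F ε U S) {x : Sp 4} (hx : x ∈ U) (k i j : Fin 4) :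
    pd k (F.g i j) x = pd k (F.g j i) x :=
  pd_congr_on k D.isOpen (fun z hz => D.reg.symm i j z hz) hx

/-- The first derivatives of the metric on `S`. -/
lemma pd_g11 (D : CharData F ε U S) (hy : y ∈ S) (i : Fin 3) :
    pd i.succ (F.g 1 1) (emb y) = 0 := by
  rw [D.pd_succ (D.reg.smooth_g 1 1) contDiffOn_const D.g11 hy, pd_const]

lemma pd_g1a (D : CharData F ε U S) (hy : y ∈ S) (i : Fin 3) (a : Fin 2) :
    pd i.succ (F.g 1 (gk a)) (emb y) = 0 := by
  rw [D.pd_succ (D.reg.smooth_g 1 (gk a)) contDiffOn_const (D.g1a a) hy, pd_const]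

lemma pd_g01 (D : CharData F ε U S) (hy : y ∈ S) (i : Fin 3) :
    pd i.succ (F.g 0 1) (emb y) = pd i F.known.g12 y := D.pd_succ_eq (D.reg.smooth_g 0 1) hy i

lemma pd_g0a (D : CharData F ε U S) (hy : y ∈ S) (i : Fin 3) (a : Fin 2) :
    pd i.succ (F.g 0 (gk a)) (emb y) = pd i (F.unkG a) y :=
  D.pd_succ_eq (D.reg.smooth_g 0 (gk a)) hy i

lemma pd_gab (D : CharData F ε U S) (hy : y ∈ S) (i : Fin 3) (a b : Fin 2) :
    pd i.succ (F.g (gk a) (gk b)) (emb y) = pd i (F.known.q a b) y :=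
  D.pd_succ_eq (D.reg.smooth_g (gk a) (gk b)) hy i

lemma pd_g110 (D : CharData F ε U S) (hy : y ∈ S) :
    pd 0 (F.g 1 1) (emb y) = 2 * pd 0 F.known.g12 y := by
  rw [D.g110 y hy]
  exact congrArg (2 * ·) (D.pd_g01 hy 0)

end CharData

lemma sum_fin_four {M : Type*} [AddCommMonoid M] (h : Fin 4 → M) :
    ∑ k, h k = h 0 + h 1 + ∑ a : Fin 2, h (gk a) := by
  rw [Fin.sum_univ_succ, Fin.sum_univ_succ, add_assoc]
  rfl

/-- Twice the Christoffel symbols of the first kind,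
`g_{mj,i} + g_{mi,j} - g_{ij,m}`. -/
def Fields.low {𝔤 : Type*} (F : Fields 𝔤) (m i j : Fin 4) : Sp 4 → ℝ := fun x =>
  pd i (F.g m j) x + pd j (F.g m i) x - pd m (F.g i j) x

lemma pd_zero_g1a {𝔤 : Type*} (F : Fields 𝔤) (y : Sp 3) (a : Fin 2) :
    pd 0 (F.g 1 (gk a)) (emb y) = F.sG a y := rfl

/-! ### Christoffel symbols on `S`. -/

namespace CharData

variable {𝔤 : Type*} [LieRing 𝔤] [LieAlgebra ℝ 𝔤] {N : ℕ} {F : Fields 𝔤}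
  {ε : Module.Basis (Fin N) ℝ 𝔤} {U : Set (Sp 4)} {S : Set (Sp 3)} {y : Sp 3}

lemma pd_one_g11 (D : CharData F ε U S) (hy : y ∈ S) : pd 1 (F.g 1 1) (emb y) = 0 :=
  D.pd_g11 hy 0

lemma pd_gk_g11 (D : CharData F ε U S) (hy : y ∈ S) (c : Fin 2) :
    pd (gk c) (F.g 1 1) (emb y) = 0 := D.pd_g11 hy (gs c)

lemma pd_one_g1a (D : CharData F ε U S) (hy : y ∈ S) (a : Fin 2) :
    pd 1 (F.g 1 (gk a)) (emb y) = 0 := D.pd_g1a hy 0 a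

lemma pd_gk_g1a (D : CharData F ε U S) (hy : y ∈ S) (c a : Fin 2) :
    pd (gk c) (F.g 1 (gk a)) (emb y) = 0 := D.pd_g1a hy (gs c) a

lemma pd_one_g01 (D : CharData F ε U S) (hy : y ∈ S) :
    pd 1 (F.g 0 1) (emb y) = pd 0 F.known.g12 y := D.pd_g01 hy 0

lemma pd_gk_g01 (D : CharData F ε U S) (hy : y ∈ S) (c : Fin 2) :
    pd (gk c) (F.g 0 1) (emb y) = pd (gs c) F.known.g12 y := D.pd_g01 hy (gs c)

lemma pd_one_g0a (D : CharData F ε U S) (hy : y ∈ S) (a : Fin 2) :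
    pd 1 (F.g 0 (gk a)) (emb y) = pd 0 (F.unkG a) y := D.pd_g0a hy 0 a

lemma pd_one_gab (D : CharData F ε U S) (hy : y ∈ S) (a b : Fin 2) :
    pd 1 (F.g (gk a) (gk b)) (emb y) = pd 0 (F.known.q a b) y := D.pd_gab hy 0 a b

lemma pd_gk_gab (D : CharData F ε U S) (hy : y ∈ S) (c a b : Fin 2) :
    pd (gk c) (F.g (gk a) (gk b)) (emb y) = pd (gs c) (F.known.q a b) y := D.pd_gab hy (gs c) a b

lemma pd_g10 (D : CharData F ε U S) (hy : y ∈ S) (k : Fin 4) :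
    pd k (F.g 1 0) (emb y) = pd k (F.g 0 1) (emb y) := D.pd_g_symm (D.sub y hy) k 1 0

lemma pd_ga0 (D : CharData F ε U S) (hy : y ∈ S) (k : Fin 4) (a : Fin 2) :
    pd k (F.g (gk a) 0) (emb y) = pd k (F.g 0 (gk a)) (emb y) := D.pd_g_symm (D.sub y hy) k _ _

lemma pd_ga1 (D : CharData F ε U S) (hy : y ∈ S) (k : Fin 4) (a : Fin 2) :
    pd k (F.g (gk a) 1) (emb y) = pd k (F.g 1 (gk a)) (emb y) := D.pd_g_symm (D.sub y hy) k _ _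

/-- For the x¹-component this is exactly the condition g_{22,1} = 2g_{12,2}; the other components
contain only tangential derivatives of g₂₂ and g_{2α}. It makes the x²-lines affinely parametrized
geodesics, Γ^k_{22} = 0. -/
lemma low_11 (D : CharData F ε U S) (hy : y ∈ S) (m : Fin 4) : F.low m 1 1 (emb y) = 0 := by
  refine Fin.cases ?_ (fun m => Fin.cases ?_ (fun a => ?_) m) m
  · simp only [Fields.low, D.pd_one_g01 hy, D.pd_g110 hy]
    ring
  · simp only [Fields.low, Fin.succ_zero_eq_one, D.pd_one_g11 hy]
    ring
  · simp only [Fields.low, D.pd_ga1 hy, D.pd_one_g1a hy, D.pd_gk_g11 hy]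
    ring

lemma low_1_1a (D : CharData F ε U S) (hy : y ∈ S) (a : Fin 2) :
    F.low 1 1 (gk a) (emb y) = 0 := by
  simp only [Fields.low, D.pd_one_g1a hy, D.pd_gk_g11 hy]
  ring

lemma low_0_1a (D : CharData F ε U S) (hy : y ∈ S) (a : Fin 2) :
    F.low 0 1 (gk a) (emb y) = pd 0 (F.unkG a) y + pd (gs a) F.known.g12 y - F.sG a y := by
  simp only [Fields.low, D.pd_one_g0a hy, D.pd_gk_g01 hy, pd_zero_g1a]

lemma low_c_1a (D : CharData F ε U S) (hy : y ∈ S) (a c : Fin 2) :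
    F.low (gk c) 1 (gk a) (emb y) = pd 0 (F.known.q c a) y := by
  simp only [Fields.low, D.pd_one_gab hy, D.pd_ga1 hy, D.pd_gk_g1a hy]
  ring

lemma low_1_10 (D : CharData F ε U S) (hy : y ∈ S) :
    F.low 1 1 0 (emb y) = 2 * pd 0 F.known.g12 y := by
  simp only [Fields.low, D.pd_g10 hy, D.pd_one_g01 hy, D.pd_g110 hy]
  ring

lemma low_a_10 (D : CharData F ε U S) (hy : y ∈ S) (a : Fin 2) :
    F.low (gk a) 1 0 (emb y) = pd 0 (F.unkG a) y + F.sG a y - pd (gs a) F.known.g12 y := by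
  simp only [Fields.low, D.pd_ga0 hy, D.pd_ga1 hy, D.pd_one_g0a hy, D.pd_g10 hy, D.pd_gk_g01 hy,
    pd_zero_g1a]

lemma low_1_ab (D : CharData F ε U S) (hy : y ∈ S) (a b : Fin 2) :
    F.low 1 (gk a) (gk b) (emb y) = -pd 0 (F.known.q a b) y := by
  simp only [Fields.low, D.pd_gk_g1a hy, D.pd_one_gab hy]
  ring

lemma low_1_a0 (D : CharData F ε U S) (hy : y ∈ S) (a : Fin 2) :
    F.low 1 (gk a) 0 (emb y) = pd (gs a) F.known.g12 y + F.sG a y - pd 0 (F.unkG a) y := by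
  simp only [Fields.low, D.pd_g10 hy, D.pd_gk_g01 hy, pd_zero_g1a, D.pd_ga0 hy, D.pd_one_g0a hy]

lemma low_c_ab (D : CharData F ε U S) (hy : y ∈ S) (a b c : Fin 2) :
    F.low (gk c) (gk a) (gk b) (emb y) = pd (gs a) (F.known.q c b) y
      + pd (gs b) (F.known.q c a) y - pd (gs c) (F.known.q a b) y := by
  simp only [Fields.low, D.pd_gk_gab hy]

lemma chr_zero (D : CharData F ε U S) (hy : y ∈ S) (i j : Fin 4) :
    F.chr 0 i j (emb y) = 1 / 2 * F.known.n y * F.low 1 i j (emb y) := by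
  simp only [Fields.chr, sum_fin_four, D.gInv_zero_zero hy, D.gInv_zero_one hy,
    D.gInv_zero_gk hy, Fields.low]
  simp
  ring

lemma chr_gk (D : CharData F ε U S) (hy : y ∈ S) (b : Fin 2) (i j : Fin 4) :
    F.chr (gk b) i j (emb y) = 1 / 2 * ∑ c, F.known.u b c y *
      (F.low (gk c) i j (emb y) - F.known.n y * F.unkG c y * F.low 1 i j (emb y)) := by
  simp only [Fields.chr, sum_fin_four, D.gInv_gk_zero hy, D.gInv_gk_one hy,
    D.gInv_gk_gk hy, Fields.low, Fin.sum_univ_two]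
  ring

lemma chr_one_1a (D : CharData F ε U S) (hy : y ∈ S) (a : Fin 2) :
    F.chr 1 1 (gk a) (emb y) = 1 / 2 * F.known.n y *
      (pd 0 (F.unkG a) y + pd (gs a) F.known.g12 y - F.sG a y
        - ∑ b, ∑ c, F.known.u b c y * F.unkG b y * pd 0 (F.known.q c a) y) := by
  have hs := D.u_symm 0 1 (D.subset_dom hy)
  have h0 := D.low_0_1a hy a
  have h1 := D.low_1_1a hy a
  have h2 := fun c => D.low_c_1a hy a c
  simp only [Fields.low] at h0 h1 h2
  simp only [Fields.chr, sum_fin_four, D.gInv_one_zero hy, D.gInv_one_gk hy, h0, h1, h2,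
    Fin.sum_univ_two]
  rw [hs]
  ring

lemma chr_11 (D : CharData F ε U S) (hy : y ∈ S) (k : Fin 4) : F.chr k 1 1 (emb y) = 0 := by
  have h := fun m => D.low_11 hy m
  simp only [Fields.low] at h
  simp [Fields.chr, h]

lemma chr_zero_1a (D : CharData F ε U S) (hy : y ∈ S) (a : Fin 2) :
    F.chr 0 1 (gk a) (emb y) = 0 := by
  rw [D.chr_zero hy, D.low_1_1a hy, mul_zero]

lemma chr_zero_10 (D : CharData F ε U S) (hy : y ∈ S) :
    F.chr 0 1 0 (emb y) = F.known.n y * pd 0 F.known.g12 y := by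
  rw [D.chr_zero hy, D.low_1_10 hy]
  ring

lemma chr_zero_a0 (D : CharData F ε U S) (hy : y ∈ S) (a : Fin 2) :
    F.chr 0 (gk a) 0 (emb y) =
      1 / 2 * F.known.n y * (pd (gs a) F.known.g12 y + F.sG a y - pd 0 (F.unkG a) y) := by
  rw [D.chr_zero hy, D.low_1_a0 hy]

lemma chr_zero_ab (D : CharData F ε U S) (hy : y ∈ S) (a b : Fin 2) :
    F.chr 0 (gk a) (gk b) (emb y) = -(1 / 2) * F.known.n y * pd 0 (F.known.q a b) y := by
  rw [D.chr_zero hy, D.low_1_ab hy]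
  ring

lemma chr_gk_1a (D : CharData F ε U S) (hy : y ∈ S) (a b : Fin 2) :
    F.chr (gk b) 1 (gk a) (emb y) =
      1 / 2 * ∑ c, F.known.u b c y * pd 0 (F.known.q c a) y := by
  simp only [D.chr_gk hy, D.low_1_1a hy, D.low_c_1a hy, mul_zero, sub_zero]

lemma chr_gk_10 (D : CharData F ε U S) (hy : y ∈ S) (b : Fin 2) :
    F.chr (gk b) 1 0 (emb y) = 1 / 2 * ∑ c, F.known.u b c y *
      (pd 0 (F.unkG c) y + F.sG c y - pd (gs c) F.known.g12 y
        - 2 * F.known.n y * F.unkG c y * pd 0 F.known.g12 y) := by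
  simp only [D.chr_gk hy, D.low_a_10 hy, D.low_1_10 hy, Fin.sum_univ_two]
  ring

lemma chr_gk_ab (D : CharData F ε U S) (hy : y ∈ S) (a b d : Fin 2) :
    F.chr (gk d) (gk a) (gk b) (emb y) = 1 / 2 * ∑ c, F.known.u d c y *
      (pd (gs a) (F.known.q c b) y + pd (gs b) (F.known.q c a) y - pd (gs c) (F.known.q a b) y
        + F.known.n y * F.unkG c y * pd 0 (F.known.q a b) y) := by
  simp only [D.chr_gk hy, D.low_c_ab hy, D.low_1_ab hy, Fin.sum_univ_two]
  ring

end CharData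

/-- The covariant components `g_{αβ} Γ^β` on the characteristic hyperplane. -/
def Fields.Y {𝔤 : Type*} (F : Fields 𝔤) (c : Fin 2) : Sp 3 → ℝ := fun y =>
  F.known.n y * (pd 0 (F.unkG c) y + F.sG c y - pd (gs c) F.known.g12 y
    - ∑ a, ∑ b, F.known.u a b y * F.unkG b y * pd 0 (F.known.q c a) y) + 1 / 2 * F.known.s c y

/-- `Γ²_{2α}` on the characteristic hyperplane. -/
def Fields.G1 {𝔤 : Type*} (F : Fields 𝔤) (a : Fin 2) : Sp 3 → ℝ := fun y =>
  1 / 2 * F.known.n y * (pd 0 (F.unkG a) y + pd (gs a) F.known.g12 y - F.sG a y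
    - ∑ b, ∑ c, F.known.u b c y * F.unkG b y * pd 0 (F.known.q c a) y)

/-- `Γ^β_{2α}` on the characteristic hyperplane. -/
def Fields.Gk {𝔤 : Type*} (F : Fields 𝔤) (b a : Fin 2) : Sp 3 → ℝ := fun y =>
  1 / 2 * ∑ c, F.known.u b c y * pd 0 (F.known.q c a) y

/-! ### The gauge functions and the transverse derivative of the connection. -/

namespace CharData

variable {𝔤 : Type*} [LieRing 𝔤] [LieAlgebra ℝ 𝔤] {N : ℕ} {F : Fields 𝔤}
  {ε : Module.Basis (Fin N) ℝ 𝔤} {U : Set (Sp 4)} {S : Set (Sp 3)} {y : Sp 3}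

lemma tr2_eq (D : CharData F ε U S) (hy : y ∈ S) :
    F.known.tr2 y = 4 * (F.known.n y * pd 0 F.known.g12 y) := by
  have h := D.g122 y hy
  have hn : F.known.n y * F.known.g12 y = 1 := n_mul_g12 (D.subset_dom hy)
  rw [Known.g122] at h
  linear_combination -F.known.n y * h - F.known.tr2 y * hn

lemma smooth_s (D : CharData F ε U S) (c : Fin 2) : ContDiffOn ℝ ∞ (F.known.s c) (F.dom U) := by
  have hu := D.smooth_u
  have hdq := fun a b i => D.pd_dom (D.smooth_q a b) i
  unfold Known.s
  fun_prop

lemma smooth_Y (D : CharData F ε U S) (c : Fin 2) : ContDiffOn ℝ ∞ (F.Y c) (F.dom U) := by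
  have hn := D.smooth_n
  have hu := D.smooth_u
  have hz := D.smooth_z
  have hs := D.smooth_sG
  have hS := D.smooth_s
  have hdz := fun a i => D.pd_dom (D.smooth_z a) i
  have hdq := fun a b i => D.pd_dom (D.smooth_q a b) i
  have hdf := fun i => D.pd_dom D.smooth_g12 i
  unfold Fields.Y
  fun_prop

lemma smooth_G1 (D : CharData F ε U S) (c : Fin 2) : ContDiffOn ℝ ∞ (F.G1 c) (F.dom U) := by
  have hn := D.smooth_n
  have hu := D.smooth_u
  have hz := D.smooth_z
  have hs := D.smooth_sG
  have hdz := fun a i => D.pd_dom (D.smooth_z a) i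
  have hdq := fun a b i => D.pd_dom (D.smooth_q a b) i
  have hdf := fun i => D.pd_dom D.smooth_g12 i
  unfold Fields.G1
  fun_prop

lemma smooth_Gk (D : CharData F ε U S) (b a : Fin 2) :
    ContDiffOn ℝ ∞ (F.Gk b a) (F.dom U) := by
  have hu := D.smooth_u
  have hdq := fun a b i => D.pd_dom (D.smooth_q a b) i
  unfold Fields.Gk
  fun_prop

/-- The gauge functions `Γ^β` on `S`. -/
lemma Γ_gk (D : CharData F ε U S) (hy : y ∈ S) (b : Fin 2) :
    F.Γ (gk b) (emb y) = ∑ c, F.known.u b c y * F.Y c y := by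
  have ht := D.tr2_eq hy
  have hsy := D.subset_dom hy
  simp only [Fields.Γ, sum_fin_four, D.gInv_zero_zero hy, D.gInv_zero_one hy,
    D.gInv_zero_gk hy, D.gInv_one_zero hy, D.gInv_gk_zero hy, D.gInv_gk_one hy,
    D.gInv_one_gk hy, D.gInv_gk_gk hy, D.chr_11 hy, D.chr_symm (D.sub y hy) (gk b) 0 1,
    fun a => D.chr_symm (D.sub y hy) (gk b) (gk a) 1, D.chr_gk_1a hy, D.chr_gk_10 hy,
    D.chr_gk_ab hy, Fields.Y, Known.s, Fin.sum_univ_two]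
  simp only [Known.tr2, Fin.sum_univ_two] at ht
  simp only [D.u_symm 1 0 hsy, fun i => D.pd_q_symm i 1 0 hsy] at ht ⊢
  linear_combination 1 / 2 * F.known.n y *
    (F.known.u b 0 y * F.unkG 0 y + F.known.u b 1 y * F.unkG 1 y) * ht

/-- The gauge function `Γ¹` vanishes on `S`. -/
lemma Γ_zero (D : CharData F ε U S) (hy : y ∈ S) : F.Γ 0 (emb y) = 0 := by
  have ht := D.tr2_eq hy
  have hsy := D.subset_dom hy
  simp only [Fields.Γ, sum_fin_four, D.gInv_zero_zero hy, D.gInv_zero_one hy,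
    D.gInv_zero_gk hy, D.gInv_one_zero hy, D.gInv_gk_zero hy, D.gInv_gk_one hy,
    D.gInv_one_gk hy, D.gInv_gk_gk hy, D.chr_11 hy, D.chr_symm (D.sub y hy) 0 0 1,
    fun a => D.chr_symm (D.sub y hy) 0 (gk a) 1, D.chr_zero_1a hy, D.chr_zero_10 hy,
    D.chr_zero_ab hy, Fin.sum_univ_two]
  simp only [Known.tr2, Fin.sum_univ_two] at ht
  simp only [D.u_symm 1 0 hsy, fun i => D.pd_q_symm i 1 0 hsy] at ht ⊢
  -- The contributions 2g^{12}Γ¹_{12} = 2n²g_{12,2} and g^{αβ}Γ¹_{αβ} = −½n g^{αβ}g_{αβ,2} cancel by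
  -- the trace condition.
  linear_combination -(1 / 2) * F.known.n y * ht

lemma q_mul_Γ (D : CharData F ε U S) (hy : y ∈ S) (a : Fin 2) :
    ∑ b, F.known.q a b y * F.Γ (gk b) (emb y) = F.Y a y := by
  have e0 := q_mul_u a 0 (D.subset_dom hy)
  have e1 := q_mul_u a 1 (D.subset_dom hy)
  simp only [D.Γ_gk hy, Fin.sum_univ_two] at *
  have key : F.Y a y = (if a = 0 then 1 else 0) * F.Y 0 y + (if a = 1 then 1 else 0) * F.Y 1 y := by
    fin_cases a <;> simp
  rw [key]
  linear_combination F.Y 0 y * e0 + F.Y 1 y * e1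

/-- The Leibniz rule for g_{αβ}Γ^β = Y_α along x². It lets the gauge terms be expressed through Y_α,
with no need to differentiate g^{αβ}Y_β. -/
lemma pd_Γ (D : CharData F ε U S) (hy : y ∈ S) (a : Fin 2) :
    ∑ b, F.known.q a b y * pd 1 (F.Γ (gk b)) (emb y) = pd 0 (F.Y a) y
      - ∑ b, pd 0 (F.known.q a b) y * F.Γ (gk b) (emb y) := by
  have hΓ := fun b => contDiffOn_comp_emb (F := F) (D.reg.contDiffOn_Γ D.isOpen (gk b))
  have hq := D.smooth_q
  have h1 := D.pd_eqOn (f := fun y => ∑ b, F.known.q a b y * F.Γ (gk b) (emb y)) (by fun_prop)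
    (D.smooth_Y a) (fun z hz => D.q_mul_Γ hz a) hy 0
  have hΓ' := fun b => ContDiffOn.diffAt (hΓ b) D.isOpen_dom (D.subset_dom hy)
  have hq' := fun a b => ContDiffOn.diffAt (hq a b) D.isOpen_dom (D.subset_dom hy)
  have h2 : ∀ b, pd 1 (F.Γ (gk b)) (emb y) = pd 0 (fun z => F.Γ (gk b) (emb z)) y := fun b =>
    D.pd_succ_eq (D.reg.contDiffOn_Γ D.isOpen (gk b)) hy 0
  simp only [Fin.sum_univ_two] at h1
  simp (disch := fun_prop) only [pd_add, pd_mul] at h1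
  simp only [h2, Fin.sum_univ_two]
  linear_combination h1

/-- Lowering an index removes the inverse metric. The identity is needed on all of `U`, because it
will be differentiated across the hyperplane. -/
lemma sum_g_mul_chr (D : CharData F ε U S) {x : Sp 4} (hx : x ∈ U) (m i j : Fin 4) :
    ∑ k, F.g m k x * F.chr k i j x = 1 / 2 * F.low m i j x := by
  have h := D.g_mul_gInv hx m
  simp only [Fields.chr, Finset.mul_sum]
  rw [Finset.sum_comm]
  have : ∀ l, ∑ k, F.g m k x * (1 / 2 * (F.gInv k l x * (pd i (F.g l j) x + pd j (F.g l i) x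
      - pd l (F.g i j) x))) = (if m = l then 1 else 0) * (1 / 2 * F.low l i j x) := by
    intro l
    rw [← h l, Finset.sum_mul]
    exact Finset.sum_congr rfl fun k _ => by rw [Fields.low]; ring
  rw [Finset.sum_congr rfl fun l _ => this l]
  simp

/-- The transverse derivative of `Γ¹_{2α}` on `S`. -/
lemma pd_zero_chr (D : CharData F ε U S) (hy : y ∈ S) (a : Fin 2) :
    pd 0 (F.chr 0 1 (gk a)) (emb y) = F.known.n y * (pd (gs a) (pd 0 F.known.g12) y
      - 2 * pd 0 F.known.g12 y * F.G1 a y - ∑ b, F.sG b y * F.Gk b a y) := by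
  have hp := D.sub y hy
  have hg := fun i j => ContDiffOn.diffAt (D.reg.smooth_g i j) D.isOpen hp
  have hc := fun k => ContDiffOn.diffAt (D.reg.contDiffOn_chr D.isOpen k 1 (gk a)) D.isOpen hp
  have hdg := ContDiffOn.diffAt (ContDiffOn.pd (i := gk a) (D.reg.smooth_g 1 1) D.isOpen)
    D.isOpen hp
  -- Differentiate g_{2k}Γ^k_{2α} = ½g_{22,α} in x¹. On `S` only g₁₂Γ¹_{2α,1} survives among the
  -- derivatives of Γ, so neither the inverse metric nor another Christoffel symbol is
  -- differentiated transversally.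
  have h1 := pd_congr_on (f := fun x => ∑ k, F.g 1 k x * F.chr k 1 (gk a) x)
    (g := fun x => 1 / 2 * pd (gk a) (F.g 1 1) x) 0 D.isOpen
    (fun x hx => by
      change ∑ k, F.g 1 k x * F.chr k 1 (gk a) x = 1 / 2 * pd (gk a) (F.g 1 1) x
      rw [D.sum_g_mul_chr hx, Fields.low]; ring) hp
  have hf : ContDiffOn ℝ ∞ (fun y => 2 * pd 0 F.known.g12 y) (F.dom U) :=
    contDiffOn_const.mul (D.pd_dom D.smooth_g12 0)
  -- After exchanging the derivatives, g_{22,1} = 2g_{12,2} is differentiated along `S`.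
  have h2 : pd 0 (pd (gk a) (F.g 1 1)) (emb y) = 2 * pd (gs a) (pd 0 F.known.g12) y := by
    rw [pd_comm 0 (gk a) (D.reg.smooth_g 1 1) D.isOpen hp]
    have hdf := ContDiffOn.diffAt (D.pd_dom D.smooth_g12 0) D.isOpen_dom (D.subset_dom hy)
    have h3 := D.pd_succ (ContDiffOn.pd (i := 0) (D.reg.smooth_g 1 1) D.isOpen) hf
      (fun z hz => D.pd_g110 hz) hy (gs a)
    rw [pd_mul _ (by fun_prop) hdf, pd_const] at h3
    rw [h3]
    ring
  simp only [sum_fin_four, Fin.sum_univ_two] at h1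
  simp (disch := fun_prop) only [pd_add, pd_mul, pd_const, h2] at h1
  have hs : F.g 1 0 (emb y) = F.known.g12 y := D.symm hy 1 0
  have hn : F.known.n y * F.known.g12 y = 1 := n_mul_g12 (D.subset_dom hy)
  simp only [D.g1a _ y hy, D.g11 y hy, hs, D.chr_zero_1a hy, D.pd_g110 hy, pd_zero_g1a,
    D.chr_one_1a hy, D.chr_gk_1a hy] at h1
  simp only [Fields.G1, Fields.Gk, Fin.sum_univ_two] at h1 ⊢
  linear_combination F.known.n y * h1 - pd 0 (F.chr 0 1 (gk a)) (emb y) * hn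

end CharData

/-! ### The Ricci components R_{2α} on `S`. -/

namespace CharData

variable {𝔤 : Type*} [LieRing 𝔤] [LieAlgebra ℝ 𝔤] {N : ℕ} {F : Fields 𝔤}
  {ε : Module.Basis (Fin N) ℝ 𝔤} {U : Set (Sp 4)} {S : Set (Sp 3)} {y : Sp 3}

/-- The trace is ½g^{αβ}g_{αβ,2}. Together with Γ¹_{12} = n g_{12,2} and Γ²_{22} = 0 it gives
Γ^k_{k2} = 3n g_{12,2}, the origin of the factors 3 below. -/
lemma sum_Gk (D : CharData F ε U S) (hy : y ∈ S) :
    ∑ b, F.Gk b b y = 2 * (F.known.n y * pd 0 F.known.g12 y) := by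
  have ht := D.tr2_eq hy
  simp only [Known.tr2, Fields.Gk, Fin.sum_univ_two] at *
  linear_combination 1 / 2 * ht

/-- The traces `Γ^k_{kγ}` on `S`. -/
lemma trace_chr (D : CharData F ε U S) (hy : y ∈ S) (c : Fin 2) :
    F.chr 0 (gk c) 0 (emb y) + F.G1 c y + ∑ b, F.chr (gk b) (gk b) (gk c) (emb y) =
      F.known.n y * pd (gs c) F.known.g12 y
        + 1 / 2 * ∑ b, ∑ d, F.known.u b d y * pd (gs c) (F.known.q b d) y := by
  have hsy := D.subset_dom hy
  -- As in a logarithmic derivative of det g, the terms in g_{2γ,1} and g_{1γ,2} cancel between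
  -- Γ¹_{1γ} and Γ²_{2γ}, and those in g_{1λ}g_{αβ,2} between Γ²_{2γ} and Γ^β_{βγ}.
  simp only [D.chr_zero_a0 hy, Fields.G1, D.chr_gk_ab hy, Fin.sum_univ_two]
  simp only [D.u_symm 1 0 hsy, fun i => D.pd_q_symm i 1 0 hsy]
  ring

/-- The Ricci components `R_{2α}` on `S`, in terms of tangential derivatives. -/
lemma ricci_eq (D : CharData F ε U S) (hy : y ∈ S) (a : Fin 2) :
    F.ricci 1 (gk a) (emb y) =
      F.known.n y * (pd (gs a) (pd 0 F.known.g12) y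
        - 2 * pd 0 F.known.g12 y * F.G1 a y - ∑ b, F.sG b y * F.Gk b a y)
      + pd 0 (F.G1 a) y + ∑ b, pd (gs b) (F.Gk b a) y
      - 3 * pd (gs a) (fun z => F.known.n z * pd 0 F.known.g12 z) y
      + 3 * (F.known.n y * pd 0 F.known.g12 y) * F.G1 a y
      + ∑ c, (F.known.n y * pd (gs c) F.known.g12 y
        + 1 / 2 * ∑ b, ∑ d, F.known.u b d y * pd (gs c) (F.known.q b d) y) * F.Gk c a y
      - (1 / 2 * F.known.n y * (pd (gs a) F.known.g12 y + F.sG a y - pd 0 (F.unkG a) y))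
        * (F.known.n y * pd 0 F.known.g12 y)
      + ∑ c, 1 / 2 * F.known.n y * pd 0 (F.known.q a c) y * F.chr (gk c) 1 0 (emb y)
      - ∑ d, F.Gk d a y * F.G1 d y
      - ∑ d, ∑ c, F.chr (gk d) (gk a) (gk c) (emb y) * F.Gk c d y := by
  have hp := D.sub y hy
  have hsy := D.subset_dom hy
  have hc := fun k i j => D.reg.contDiffOn_chr D.isOpen k i j
  have hnf : ContDiffOn ℝ ∞ (fun z => F.known.n z * pd 0 F.known.g12 z) (F.dom U) :=
    D.smooth_n.mul (D.pd_dom D.smooth_g12 0)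
  have e1 : pd (gk a) (F.chr 0 1 0) (emb y) =
      pd (gs a) (fun z => F.known.n z * pd 0 F.known.g12 z) y :=
    D.pd_succ (hc _ _ _) hnf (fun z hz => D.chr_zero_10 hz) hy (gs a)
  have e2 : pd 1 (F.chr 1 1 (gk a)) (emb y) = pd 0 (F.G1 a) y :=
    D.pd_succ (hc _ _ _) (D.smooth_G1 a) (fun z hz => D.chr_one_1a hz a) hy 0
  have e3 : pd (gk a) (F.chr 1 1 1) (emb y) = 0 := by
    have h : pd (gk a) (F.chr 1 1 1) (emb y) = pd (gs a) (fun _ => (0 : ℝ)) y :=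
      D.pd_succ (hc _ _ _) contDiffOn_const (fun z hz => D.chr_11 hz 1) hy (gs a)
    rw [h, pd_const]
  have e4 : ∀ b, pd (gk b) (F.chr (gk b) 1 (gk a)) (emb y) = pd (gs b) (F.Gk b a) y := fun b =>
    D.pd_succ (hc _ _ _) (D.smooth_Gk b a) (fun z hz => D.chr_gk_1a hz a b) hy (gs b)
  have e5 : ∀ b, pd (gk a) (F.chr (gk b) 1 (gk b)) (emb y) = pd (gs a) (F.Gk b b) y := fun b =>
    D.pd_succ (hc _ _ _) (D.smooth_Gk b b) (fun z hz => D.chr_gk_1a hz b b) hy (gs a)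
  -- The trace identity holds on all of `S`, so it may be differentiated in x^α.
  have e6 : ∑ b, pd (gs a) (F.Gk b b) y =
      2 * pd (gs a) (fun z => F.known.n z * pd 0 F.known.g12 z) y := by
    have hG := fun b => ContDiffOn.diffAt (D.smooth_Gk b b) D.isOpen_dom hsy
    have hd := ContDiffOn.diffAt hnf D.isOpen_dom hsy
    have h := D.pd_eqOn (ContDiffOn.sum fun b _ => D.smooth_Gk b b) (contDiffOn_const.mul hnf)
      (fun z hz => D.sum_Gk hz) hy (gs a)
    rw [pd_sum _ hG, pd_mul _ (by fun_prop) hd, pd_const] at h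
    rw [h]
    ring
  have e7 := D.sum_Gk hy
  have s1 : ∀ k i, F.chr k (gk i) 1 (emb y) = F.chr k 1 (gk i) (emb y) := fun k i =>
    D.chr_symm hp k _ _
  have s2 : ∀ k i, F.chr k 0 (gk i) (emb y) = F.chr k (gk i) 0 (emb y) := fun k i =>
    D.chr_symm hp k _ _
  have s3 : ∀ k, F.chr k 0 1 (emb y) = F.chr k 1 0 (emb y) := fun k => D.chr_symm hp k _ _
  have f1 : ∀ c, F.chr 1 1 (gk c) (emb y) = F.G1 c y := fun c => D.chr_one_1a hy c
  have f2 : ∀ b c, F.chr (gk b) 1 (gk c) (emb y) = F.Gk b c y := fun b c => D.chr_gk_1a hy c b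
  have f3 := fun c => D.trace_chr hy c
  simp only [Fin.sum_univ_two] at e6 e7 f3
  simp only [Fields.ricci, sum_fin_four, D.pd_zero_chr hy, e1, e2, e3, e4, e5, s1, s2, s3,
    D.chr_11 hy, D.chr_zero_1a hy, D.chr_zero_10 hy, f1, f2, D.chr_zero_ab hy, Fin.sum_univ_two]
  have f30 := f3 0
  have f31 := f3 1
  rw [← f30, ← f31]
  rw [← D.chr_zero_a0 hy]
  linear_combination -e6 + F.G1 a y * e7

end CharData

/-! ### The first combination. -/

lemma q_mul_br {𝔤 : Type*} {F : Fields 𝔤} {U : Set (Sp 4)} {y : Sp 3} (a : Fin 2)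
    (hy : y ∈ F.dom U) :
    ∑ b, F.known.q a b y * F.known.br b y =
      -2 * F.known.n y * pd (gs a) F.known.g12 y + F.known.s a y := by
  have e0 := q_mul_u a 0 hy
  have e1 := q_mul_u a 1 hy
  simp only [Known.br, Fin.sum_univ_two] at *
  have key : -2 * F.known.n y * pd (gs a) F.known.g12 y + F.known.s a y =
      (if a = 0 then 1 else 0) * (-2 * F.known.n y * pd (gs 0) F.known.g12 y + F.known.s 0 y)
      + (if a = 1 then 1 else 0) * (-2 * F.known.n y * pd (gs 1) F.known.g12 y
        + F.known.s 1 y) := by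
    fin_cases a <;> simp
  rw [key]
  linear_combination (-2 * F.known.n y * pd (gs 0) F.known.g12 y + F.known.s 0 y) * e0
    + (-2 * F.known.n y * pd (gs 1) F.known.g12 y + F.known.s 1 y) * e1

namespace CharData

variable {𝔤 : Type*} [LieRing 𝔤] [LieAlgebra ℝ 𝔤] {N : ℕ} {F : Fields 𝔤}
  {ε : Module.Basis (Fin N) ℝ 𝔤} {U : Set (Sp 4)} {S : Set (Sp 3)} {y : Sp 3}

lemma smooth_br (D : CharData F ε U S) (b : Fin 2) :
    ContDiffOn ℝ ∞ (F.known.br b) (F.dom U) := by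
  have hn := D.smooth_n
  have hu := D.smooth_u
  have hS := D.smooth_s
  have hdf := fun i => D.pd_dom D.smooth_g12 i
  unfold Known.br
  fun_prop

lemma q_mul_pd_u (D : CharData F ε U S) (i : Fin 3) (a l : Fin 2) (hy : y ∈ F.dom U) :
    ∑ b, F.known.q a b y * pd i (F.known.u b l) y =
      -∑ b, pd i (F.known.q a b) y * F.known.u b l y := by
  have hu := fun a b => ContDiffOn.diffAt (D.smooth_u a b) D.isOpen_dom hy
  have hq := fun a b => ContDiffOn.diffAt (D.smooth_q a b) D.isOpen_dom hy
  have h := pd_congr_on (f := fun y => ∑ c, F.known.q a c y * F.known.u c l y) i D.isOpen_dom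
    (fun z hz => q_mul_u a l hz) hy
  simp only [Fin.sum_univ_two] at *
  simp (disch := fun_prop) only [pd_add, pd_mul, pd_const] at h
  linear_combination h

/-- The identity g_{αβ}g^{βλ} = δ_α^λ differentiated twice. It trades g^{βλ}_{,22} in `Known.χ₀` for
second derivatives of g_{αβ}, the form in which they arise from the Ricci tensor. -/
lemma q_mul_pd_pd_u (D : CharData F ε U S) (i : Fin 3) (a l : Fin 2) (hy : y ∈ F.dom U) :
    ∑ b, F.known.q a b y * pd i (pd i (F.known.u b l)) y =
      -∑ b, (2 * pd i (F.known.q a b) y * pd i (F.known.u b l) y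
        + pd i (pd i (F.known.q a b)) y * F.known.u b l y) := by
  have hu := fun a b => ContDiffOn.diffAt (D.smooth_u a b) D.isOpen_dom hy
  have hq := fun a b => ContDiffOn.diffAt (D.smooth_q a b) D.isOpen_dom hy
  have hdu := fun a b => ContDiffOn.diffAt (D.pd_dom (D.smooth_u a b) i) D.isOpen_dom hy
  have hdq := fun a b => ContDiffOn.diffAt (D.pd_dom (D.smooth_q a b) i) D.isOpen_dom hy
  have h := pd_congr_on (f := fun y => ∑ b, F.known.q a b y * pd i (F.known.u b l) y) i
    D.isOpen_dom (fun z hz => D.q_mul_pd_u i a l hz) hy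
  simp only [Fin.sum_univ_two] at *
  simp (disch := fun_prop) only [pd_add, pd_mul, pd_neg] at h
  linear_combination h

lemma q_mul_pd_br (D : CharData F ε U S) (i : Fin 3) (a : Fin 2) (hy : y ∈ F.dom U) :
    ∑ b, F.known.q a b y * pd i (F.known.br b) y =
      -2 * (pd i F.known.n y * pd (gs a) F.known.g12 y
        + F.known.n y * pd i (pd (gs a) F.known.g12) y) + pd i (F.known.s a) y
      - ∑ b, pd i (F.known.q a b) y * F.known.br b y := by
  have hq := fun a b => ContDiffOn.diffAt (D.smooth_q a b) D.isOpen_dom hy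
  have hbr := fun b => ContDiffOn.diffAt (D.smooth_br b) D.isOpen_dom hy
  have hn := ContDiffOn.diffAt D.smooth_n D.isOpen_dom hy
  have hs := fun b => ContDiffOn.diffAt (D.smooth_s b) D.isOpen_dom hy
  have hdf := fun i => ContDiffOn.diffAt (D.pd_dom D.smooth_g12 i) D.isOpen_dom hy
  have h := pd_congr_on (f := fun y => ∑ b, F.known.q a b y * F.known.br b y) i
    D.isOpen_dom (fun z hz => q_mul_br a hz) hy
  simp only [Fin.sum_univ_two] at *
  simp (disch := fun_prop) only [pd_add, pd_mul, pd_const] at h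
  linear_combination h

/-- The first combination, on `S`. -/
theorem combR_eq (D : CharData F ε U S) (hy : y ∈ S) (a : Fin 2) :
    F.combR a (emb y) = F.known.rhsR F.unkG a y := by
  have hsy := D.subset_dom hy
  have hn := ContDiffOn.diffAt D.smooth_n D.isOpen_dom hsy
  have hu := fun a b => ContDiffOn.diffAt (D.smooth_u a b) D.isOpen_dom hsy
  have hz := fun b => ContDiffOn.diffAt (D.smooth_z b) D.isOpen_dom hsy
  have hsG := fun b => ContDiffOn.diffAt (D.smooth_sG b) D.isOpen_dom hsy
  have hs := fun b => ContDiffOn.diffAt (D.smooth_s b) D.isOpen_dom hsy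
  have hdf := fun i => ContDiffOn.diffAt (D.pd_dom D.smooth_g12 i) D.isOpen_dom hsy
  have hdz := fun b i => ContDiffOn.diffAt (D.pd_dom (D.smooth_z b) i) D.isOpen_dom hsy
  have hdq := fun a b i => ContDiffOn.diffAt (D.pd_dom (D.smooth_q a b) i) D.isOpen_dom hsy
  have hcm : pd 0 (pd (gs a) F.known.g12) y = pd (gs a) (pd 0 F.known.g12) y :=
    pd_comm _ _ D.smooth_g12 D.isOpen_dom hsy
  -- The gauge terms are ½Y_{α,2} + n g_{12,2}Y_α. Since Y_α contains n g_{2α,1} and Γ²_{2α}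
  -- contains −½n g_{2α,1}, the undetermined g_{2α,1} disappears from Γ²_{2α,2} + ½Y_{α,2} up to
  -- g_{αβ,2} terms, which −n g_{2β,1}Γ^β_{2α} and the remaining products absorb.
  have hL : F.combR a (emb y) = F.ricci 1 (gk a) (emb y) + 1 / 2 * pd 0 (F.Y a) y
      + F.known.n y * pd 0 F.known.g12 y * F.Y a y := by
    have h1 := D.pd_Γ hy a
    have h2 := D.q_mul_Γ hy a
    have h3 : ∀ b, F.g (gk a) (gk b) (emb y) = F.known.q a b y := fun _ => rfl
    simp only [Fields.combR, D.gInv_zero_one hy, D.pd_one_g01 hy, D.pd_one_gab hy, h3,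
      Fin.sum_univ_two] at *
    linear_combination 1 / 2 * h1 + F.known.n y * pd 0 F.known.g12 y * h2
  have hχ : ∀ l, F.known.χ₀ a l y = -∑ b, F.known.n y *
      (F.known.n y * pd 0 F.known.g12 y * (pd 0 (F.known.q a b) y * F.known.u b l y)
        + pd 0 (F.known.q a b) y * pd 0 (F.known.u b l) y
        + pd 0 (pd 0 (F.known.q a b)) y * F.known.u b l y) := by
    intro l
    have h1 := D.q_mul_pd_u 0 a l hsy
    have h2 := D.q_mul_pd_pd_u 0 a l hsy
    simp only [Known.χ₀, Known.g122, Fin.sum_univ_two] at *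
    linear_combination F.known.n y ^ 2 * pd 0 F.known.g12 y * h1 + 1 / 2 * F.known.n y * h2
  have hbr := D.q_mul_pd_br 0 a hsy
  have hg221 : pd (gs a) F.known.g221 y = 2 * pd (gs a) (pd 0 F.known.g12) y := by
    have h : pd (gs a) F.known.g221 y = pd (gs a) (fun z => 2 * pd 0 F.known.g12 z) y := rfl
    rw [h, pd_mul _ (by fun_prop) (hdf 0), pd_const]
    ring
  rw [hL, D.ricci_eq hy]
  simp only [Known.rhsR, Known.c, hχ, hg221]
  simp only [Known.g122, D.chr_gk_10 hy, D.chr_gk_ab hy, Fin.sum_univ_two] at hbr ⊢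
  unfold Fields.Y Fields.G1 Fields.Gk
  simp only [Fin.sum_univ_two]
  simp (disch := fun_prop) only [pd_add, pd_sub, pd_mul, pd_const]
  simp only [hcm, D.pd_n _ hsy, D.pd_u _ _ _ hsy, Fin.sum_univ_two] at hbr ⊢
  have hpq := fun i => D.pd_q_symm i 1 0 hsy
  have hppq := fun i j => D.pd_pd_q_symm i j 1 0 hsy
  fin_cases a <;>
  · dsimp only [Fin.zero_eta, Fin.mk_one, Fin.isValue] at hbr ⊢
    simp only [D.u_symm 1 0 hsy, hpq, hppq] at hbr ⊢
    -- The two terms of c_α in B^β add up to ¼(g_{αβ}B^β)_{,2}, where g_{αβ}B^β is free of the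
    -- inverse metric outside n and the trace `Known.s`; this is the known part of ½Y_{α,2}.
    linear_combination -(1 / 4) * hbr

end CharData

/-! ### The field strength and the Lorentz gauge quantity on `S`. -/

namespace Fields

variable {𝔤 : Type*} [LieRing 𝔤] [LieAlgebra ℝ 𝔤] {N : ℕ}

lemma curv_antisymm (F : Fields 𝔤) (ε : Module.Basis (Fin N) ℝ 𝔤) (i j : Fin 4) (x : Sp 4) :
    F.curv ε i j x = -F.curv ε j i x := by
  simp only [curv]
  rw [← lie_skew (F.A j x) (F.A i x)]
  abel

lemma curvUp_antisymm (F : Fields 𝔤) (ε : Module.Basis (Fin N) ℝ 𝔤) (i j : Fin 4) (x : Sp 4) :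
    F.curvUp ε i j x = -F.curvUp ε j i x := by
  simp only [curvUp, ← Finset.sum_neg_distrib]
  rw [Finset.sum_comm]
  refine Finset.sum_congr rfl fun a _ => Finset.sum_congr rfl fun b _ => ?_
  rw [F.curv_antisymm ε b a, smul_neg, mul_comm]

lemma curvUp_self (F : Fields 𝔤) (ε : Module.Basis (Fin N) ℝ 𝔤) (i : Fin 4) (x : Sp 4) :
    F.curvUp ε i i x = 0 := by
  have h := F.curvUp_antisymm ε i i x
  have h2 : (2 : ℝ) • F.curvUp ε i i x = 0 := by
    rw [two_smul]
    nth_rewrite 2 [h]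
    exact add_neg_cancel _
  simpa using h2

/-- Contracting the connection first isolates −Γ^lA_l. On `S`, where Γ¹ = 0 and A₂ = 0, adding
Γ^γA_γ then leaves only derivatives of the potential. -/
lemma Δ_eq (F : Fields 𝔤) (ε : Module.Basis (Fin N) ℝ 𝔤) (x : Sp 4) :
    F.Δ ε x = ∑ i, ∑ k, F.gInv i k x • pdL ε i (F.A k) x - ∑ l, F.Γ l x • F.A l x := by
  simp only [Δ, Γ, smul_sub, Finset.sum_sub_distrib, Finset.smul_sum, Finset.sum_smul, smul_smul]
  rw [sub_right_inj]
  symm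
  rw [Finset.sum_comm]
  exact Finset.sum_congr rfl fun i _ => Finset.sum_comm

end Fields

namespace CharData

variable {𝔤 : Type*} [LieRing 𝔤] [LieAlgebra ℝ 𝔤] {N : ℕ} {F : Fields 𝔤}
  {ε : Module.Basis (Fin N) ℝ 𝔤} {U : Set (Sp 4)} {S : Set (Sp 3)} {y : Sp 3}

lemma pdL_succ (D : CharData F ε U S) {f : Sp 4 → 𝔤}
    (hf : ∀ I, ContDiffOn ℝ ∞ (fun x => ε.repr (f x) I) U) (hy : y ∈ S) (i : Fin 3) :
    pdL ε i.succ f (emb y) = pdL ε i (fun z => f (emb z)) y := by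
  simp only [pdL]
  exact Finset.sum_congr rfl fun I _ => by rw [D.pd_succ_eq (hf I) hy i]

lemma pdL_one_Aa (D : CharData F ε U S) (hy : y ∈ S) (a : Fin 2) :
    pdL ε 1 (F.A (gk a)) (emb y) = pdL ε 0 (F.known.A a) y :=
  D.pdL_succ (D.reg.smooth_A (gk a)) hy 0

lemma pdL_gk_Aa (D : CharData F ε U S) (hy : y ∈ S) (c a : Fin 2) :
    pdL ε (gk c) (F.A (gk a)) (emb y) = pdL ε (gs c) (F.known.A a) y :=
  D.pdL_succ (D.reg.smooth_A (gk a)) hy (gs c)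

lemma pdL_one_A0 (D : CharData F ε U S) (hy : y ∈ S) :
    pdL ε 1 (F.A 0) (emb y) = pdL ε 0 F.unkA y := D.pdL_succ (D.reg.smooth_A 0) hy 0

lemma pdL_one_Φ (D : CharData F ε U S) (hy : y ∈ S) :
    pdL ε 1 F.Φ (emb y) = pdL ε 0 F.known.Φ y := D.pdL_succ D.reg.smooth_Φ hy 0

lemma pdL_gk_Φ (D : CharData F ε U S) (hy : y ∈ S) (c : Fin 2) :
    pdL ε (gk c) F.Φ (emb y) = pdL ε (gs c) F.known.Φ y := D.pdL_succ D.reg.smooth_Φ hy (gs c)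

lemma pdL_succ_A1 (D : CharData F ε U S) (hy : y ∈ S) (i : Fin 3) :
    pdL ε i.succ (F.A 1) (emb y) = 0 := by
  simp only [pdL]
  refine Finset.sum_eq_zero fun I _ => ?_
  rw [D.pd_succ (g := fun _ => 0) (D.reg.smooth_A 1 I) contDiffOn_const
    (fun z hz => by simp [D.A1 z hz]) hy, pd_const, zero_smul]

lemma pdL_one_A1 (D : CharData F ε U S) (hy : y ∈ S) : pdL ε 1 (F.A 1) (emb y) = 0 :=
  D.pdL_succ_A1 hy 0

lemma pdL_gk_A1 (D : CharData F ε U S) (hy : y ∈ S) (c : Fin 2) :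
    pdL ε (gk c) (F.A 1) (emb y) = 0 := D.pdL_succ_A1 hy (gs c)

lemma curv_01 (D : CharData F ε U S) (hy : y ∈ S) :
    F.curv ε 0 1 (emb y) = pdL ε 0 (F.A 1) (emb y) - pdL ε 0 F.unkA y := by
  simp [Fields.curv, D.pdL_one_A0 hy, D.A1 y hy]

lemma curv_11 (D : CharData F ε U S) (hy : y ∈ S) : F.curv ε 1 1 (emb y) = 0 := by
  simp [Fields.curv, D.A1 y hy]

lemma curv_a1 (D : CharData F ε U S) (hy : y ∈ S) (a : Fin 2) :
    F.curv ε (gk a) 1 (emb y) = -pdL ε 0 (F.known.A a) y := by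
  simp only [Fields.curv, D.pdL_one_Aa hy, D.pdL_gk_A1 hy, D.A1 y hy, lie_zero]
  simp

lemma curv_ab (D : CharData F ε U S) (hy : y ∈ S) (a b : Fin 2) :
    F.curv ε (gk a) (gk b) (emb y) = pdL ε (gs a) (F.known.A b) y
      - pdL ε (gs b) (F.known.A a) y + ⁅F.known.A a y, F.known.A b y⁆ := by
  simp only [Fields.curv, D.pdL_gk_Aa hy]
  rfl

/-- As g^{1b} is nonzero only for b = 2, raising the second index to 1 leaves F_{a2}. Hence F_{1α},
which contains the undetermined A_{α,1}, does not enter. -/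
lemma curvUp_zero (D : CharData F ε U S) (hy : y ∈ S) (i : Fin 4) :
    F.curvUp ε i 0 (emb y) = F.known.n y • ∑ a, F.gInv i a (emb y) • F.curv ε a 1 (emb y) := by
  simp only [Fields.curvUp, sum_fin_four, D.gInv_zero_zero hy, D.gInv_zero_one hy,
    D.gInv_zero_gk hy, Fin.sum_univ_two]
  module

lemma curvUp_10 (D : CharData F ε U S) (hy : y ∈ S) :
    F.curvUp ε 1 0 (emb y) =
      F.known.n y ^ 2 • (pdL ε 0 (F.A 1) (emb y) - pdL ε 0 F.unkA y
        + ∑ a, ∑ b, (F.known.u a b y * F.unkG b y) • pdL ε 0 (F.known.A a) y) := by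
  simp only [D.curvUp_zero hy, sum_fin_four, D.gInv_one_zero hy, D.gInv_one_gk hy, D.curv_01 hy,
    D.curv_11 hy, D.curv_a1 hy, Fin.sum_univ_two]
  module

lemma curvUp_a0 (D : CharData F ε U S) (hy : y ∈ S) (a : Fin 2) :
    F.curvUp ε (gk a) 0 (emb y) =
      -(F.known.n y • ∑ c, F.known.u a c y • pdL ε 0 (F.known.A c) y) := by
  simp only [D.curvUp_zero hy, sum_fin_four, D.gInv_gk_zero hy, D.gInv_gk_gk hy,
    D.curv_11 hy, D.curv_a1 hy, Fin.sum_univ_two]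
  module

/-- `Δ + Γ^γ A_γ` on `S`. -/
lemma Δ_add (D : CharData F ε U S) (hy : y ∈ S) :
    F.Δ ε (emb y) + ∑ c, F.Γ (gk c) (emb y) • F.known.A c y =
      F.known.n y • (pdL ε 0 (F.A 1) (emb y) + pdL ε 0 F.unkA y
        - ∑ a, ∑ b, (F.known.u a b y * F.unkG b y) • pdL ε 0 (F.known.A a) y)
      + ∑ a, ∑ b, F.known.u a b y • pdL ε (gs b) (F.known.A a) y := by
  have h : ∀ c, F.A (gk c) (emb y) = F.known.A c y := fun _ => rfl
  simp only [Fields.Δ_eq, sum_fin_four, D.gInv_zero_zero hy, D.gInv_zero_one hy,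
    D.gInv_zero_gk hy, D.gInv_one_zero hy, D.gInv_gk_zero hy, D.gInv_gk_one hy,
    D.gInv_one_gk hy, D.gInv_gk_gk hy, D.pdL_one_A0 hy, D.pdL_one_A1 hy, D.pdL_gk_A1 hy,
    D.pdL_one_Aa hy, D.pdL_gk_Aa hy, D.Γ_zero hy, D.A1 y hy, h, Fin.sum_univ_two]
  simp only [D.u_symm 1 0 (D.subset_dom hy)]
  module

end CharData

/-! ### The gauge covariant divergence on `S`. -/

namespace Fields

variable {𝔤 : Type*} [LieRing 𝔤] [LieAlgebra ℝ 𝔤] {N : ℕ}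

/-- The components of `F^{21}` on the characteristic hyperplane. -/
def E1 (F : Fields 𝔤) (ε : Module.Basis (Fin N) ℝ 𝔤) (I : Fin N) : Sp 3 → ℝ := fun y =>
  F.known.n y ^ 2 * (F.sA ε I y - pd 0 (fun z => ε.repr (F.unkA z) I) y
    + ∑ a, ∑ b, F.known.u a b y * F.unkG b y * pd 0 (fun z => ε.repr (F.known.A a z) I) y)

/-- The components of `F^{α1}` on the characteristic hyperplane. -/
def Ek (F : Fields 𝔤) (ε : Module.Basis (Fin N) ℝ 𝔤) (a : Fin 2) (I : Fin N) : Sp 3 → ℝ :=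
  fun y => -(F.known.n y *
    ∑ c, F.known.u a c y * pd 0 (fun z => ε.repr (F.known.A c z) I) y)

/-- The components of `Δ + Γ^γ A_γ` on the characteristic hyperplane. -/
def ΔΓ (F : Fields 𝔤) (ε : Module.Basis (Fin N) ℝ 𝔤) (I : Fin N) : Sp 3 → ℝ := fun y =>
  F.known.n y * (F.sA ε I y + pd 0 (fun z => ε.repr (F.unkA z) I) y
    - ∑ a, ∑ b, F.known.u a b y * F.unkG b y * pd 0 (fun z => ε.repr (F.known.A a z) I) y)
  + ∑ a, ∑ b, F.known.u a b y * pd (gs b) (fun z => ε.repr (F.known.A a z) I) y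

end Fields

namespace CharData

variable {𝔤 : Type*} [LieRing 𝔤] [LieAlgebra ℝ 𝔤] {N : ℕ} {F : Fields 𝔤}
  {ε : Module.Basis (Fin N) ℝ 𝔤} {U : Set (Sp 4)} {S : Set (Sp 3)} {y : Sp 3}

lemma smooth_E1 (D : CharData F ε U S) (I : Fin N) : ContDiffOn ℝ ∞ (F.E1 ε I) (F.dom U) := by
  have hn := D.smooth_n
  have hu := D.smooth_u
  have hz := D.smooth_z
  have hs := D.smooth_sA I
  have hdX := D.pd_dom (D.smooth_unkA I) 0
  have hdA := fun a i => D.pd_dom (D.smooth_A a I) i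
  unfold Fields.E1
  fun_prop

lemma smooth_Ek (D : CharData F ε U S) (a : Fin 2) (I : Fin N) :
    ContDiffOn ℝ ∞ (F.Ek ε a I) (F.dom U) := by
  have hn := D.smooth_n
  have hu := D.smooth_u
  have hdA := fun a i => D.pd_dom (D.smooth_A a I) i
  unfold Fields.Ek
  fun_prop

lemma smooth_ΔΓ (D : CharData F ε U S) (I : Fin N) : ContDiffOn ℝ ∞ (F.ΔΓ ε I) (F.dom U) := by
  have hn := D.smooth_n
  have hu := D.smooth_u
  have hz := D.smooth_z
  have hs := D.smooth_sA I
  have hdX := D.pd_dom (D.smooth_unkA I) 0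
  have hdA := fun a i => D.pd_dom (D.smooth_A a I) i
  unfold Fields.ΔΓ
  fun_prop

lemma repr_curvUp_10 (D : CharData F ε U S) (hy : y ∈ S) (I : Fin N) :
    ε.repr (F.curvUp ε 1 0 (emb y)) I = F.E1 ε I y := by
  rw [D.curvUp_10 hy]
  simp only [map_smul, map_add, map_sub, map_sum, Finsupp.smul_apply, Finsupp.add_apply,
    Finsupp.sub_apply, Finsupp.coe_finsetSum, Finset.sum_apply, smul_eq_mul, repr_pdL]
  rfl

lemma repr_curvUp_a0 (D : CharData F ε U S) (hy : y ∈ S) (a : Fin 2) (I : Fin N) :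
    ε.repr (F.curvUp ε (gk a) 0 (emb y)) I = F.Ek ε a I y := by
  rw [D.curvUp_a0 hy]
  simp only [map_smul, map_neg, map_sum, Finsupp.smul_apply, Finsupp.neg_apply,
    Finsupp.coe_finsetSum, Finset.sum_apply, smul_eq_mul, repr_pdL]
  rfl

lemma repr_Δ_add (D : CharData F ε U S) (hy : y ∈ S) (I : Fin N) :
    ε.repr (F.Δ ε (emb y)) I + ∑ c, F.Γ (gk c) (emb y) * ε.repr (F.known.A c y) I =
      F.ΔΓ ε I y := by
  have h := congrArg (fun v => ε.repr v I) (D.Δ_add hy)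
  simp only [map_smul, map_add, map_sub, map_sum, Finsupp.smul_apply, Finsupp.add_apply,
    Finsupp.sub_apply, Finsupp.coe_finsetSum, Finset.sum_apply, smul_eq_mul, repr_pdL] at h
  exact h

/-- The component `∇̂_i F^{i1}` of the gauge divergence on `S`. -/
lemma repr_divCurv (D : CharData F ε U S) (hy : y ∈ S) (I : Fin N) :
    ε.repr (F.divCurv ε 0 (emb y)) I =
      pd 0 (F.E1 ε I) y + ∑ a, pd (gs a) (F.Ek ε a I) y
      + 3 * (F.known.n y * pd 0 F.known.g12 y) * F.E1 ε I y
      + ∑ c, (F.known.n y * pd (gs c) F.known.g12 y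
        + 1 / 2 * ∑ b, ∑ d, F.known.u b d y * pd (gs c) (F.known.q b d) y) * F.Ek ε c I y
      - F.known.n y * ∑ a, ∑ c, F.known.u a c y *
        ε.repr ⁅F.known.A a y, pdL ε 0 (F.known.A c) y⁆ I := by
  have hp := D.sub y hy
  have hF := fun i j => D.reg.contDiffOn_curvUp D.isOpen i j I
  -- Symmetric against antisymmetric: this eliminates Γ¹_{im}F^{im} and leaves only the traces
  -- Γ^i_{im}.
  have h0 : ∑ i, ∑ m, F.chr 0 i m (emb y) • F.curvUp ε i m (emb y) = 0 :=
    sum_smul_eq_zero _ _ (fun i j => D.chr_symm hp 0 i j) fun i j => F.curvUp_antisymm ε i j _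
  have h0' := congrArg (fun v => ε.repr v I) h0
  have e1 : pd 1 (fun z => ε.repr (F.curvUp ε 1 0 z) I) (emb y) = pd 0 (F.E1 ε I) y :=
    D.pd_succ (hF _ _) (D.smooth_E1 I) (fun z hz => D.repr_curvUp_10 hz I) hy 0
  have e2 : ∀ a, pd (gk a) (fun z => ε.repr (F.curvUp ε (gk a) 0 z) I) (emb y) =
      pd (gs a) (F.Ek ε a I) y := fun a =>
    D.pd_succ (hF _ _) (D.smooth_Ek a I) (fun z hz => D.repr_curvUp_a0 hz a I) hy (gs a)
  have e3 : ∀ a, ε.repr ⁅F.A (gk a) (emb y), F.curvUp ε (gk a) 0 (emb y)⁆ I =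
      -(F.known.n y * ∑ c, F.known.u a c y *
        ε.repr ⁅F.known.A a y, pdL ε 0 (F.known.A c) y⁆ I) := by
    intro a
    rw [D.curvUp_a0 hy]
    simp only [lie_neg, lie_smul, lie_sum, map_smul, map_neg, map_sum, Finsupp.smul_apply,
      Finsupp.neg_apply, Finsupp.coe_finsetSum, Finset.sum_apply, smul_eq_mul]
    rfl
  have f1 : ∀ c, F.chr 1 1 (gk c) (emb y) = F.G1 c y := fun c => D.chr_one_1a hy c
  have f2 : ∀ b c, F.chr (gk b) (gk c) 1 (emb y) = F.Gk b c y := fun b c =>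
    (D.chr_symm hp _ _ _).trans (D.chr_gk_1a hy c b)
  have f3 := D.trace_chr hy
  have f4 := D.sum_Gk hy
  have s1 : ∀ i, F.chr 0 0 (gk i) (emb y) = F.chr 0 (gk i) 0 (emb y) := fun i =>
    D.chr_symm hp 0 _ _
  have s2 : F.chr 0 0 1 (emb y) = F.known.n y * pd 0 F.known.g12 y :=
    (D.chr_symm hp 0 _ _).trans (D.chr_zero_10 hy)
  simp only [map_smul, map_zero, map_sum, Finsupp.smul_apply, Finsupp.zero_apply,
    Finsupp.coe_finsetSum, Finset.sum_apply, smul_eq_mul] at h0'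
  simp only [Fields.divCurv, map_smul, map_add, map_sum, Finsupp.smul_apply, Finsupp.add_apply,
    Finsupp.coe_finsetSum, Finset.sum_apply, smul_eq_mul, repr_pdL]
  simp only [sum_fin_four, pd_const, e1, e2, e3, f1, f2, s1, s2, D.chr_11 hy, D.A1 y hy, zero_lie,
    F.curvUp_self ε 0, lie_zero, map_zero, Finsupp.zero_apply, D.repr_curvUp_10 hy,
    D.repr_curvUp_a0 hy, Fin.sum_univ_two] at h0' f3 f4 ⊢
  rw [← f3 0, ← f3 1]
  linear_combination h0' + F.E1 ε I y * f4

/-- Lowering with g_{j2} keeps only the component ∇̂_iF^{i1}. By the Leibniz rule the remaining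
terms collect into D = Δ + Γ^νA_ν and its x²-derivative, where Γ¹ = 0 and A₂ = 0 on `S` remove the
other two Γ^lA_l. -/
lemma repr_combA (D : CharData F ε U S) (hy : y ∈ S) (I : Fin N) :
    ε.repr (F.combA ε (emb y)) I = F.known.g12 y * ε.repr (F.divCurv ε 0 (emb y)) I
      - pd 0 (F.ΔΓ ε I) y - 2 * (F.known.n y * pd 0 F.known.g12 y) * F.ΔΓ ε I y := by
  have hp := D.sub y hy
  have hsy := D.subset_dom hy
  have hΔ := D.reg.contDiffOn_Δ D.isOpen I
  have hΓ := fun b => D.reg.contDiffOn_Γ D.isOpen b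
  have hΔ3 : ContDiffOn ℝ ∞ (fun z => ε.repr (F.Δ ε (emb z)) I) (F.dom U) :=
    contDiffOn_comp_emb (F := F) hΔ
  have hΓ3 := fun b => contDiffOn_comp_emb (F := F) (hΓ b)
  have hA := fun a => D.smooth_A a I
  have hΔd := ContDiffOn.diffAt hΔ3 D.isOpen_dom hsy
  have hΓd := fun b => ContDiffOn.diffAt (hΓ3 b) D.isOpen_dom hsy
  have hAd := fun a => ContDiffOn.diffAt (hA a) D.isOpen_dom hsy
  have h1 := D.repr_Δ_add hy I
  have h2 := D.pd_eqOn (f := fun y => ε.repr (F.Δ ε (emb y)) I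
      + ∑ c, F.Γ (gk c) (emb y) * ε.repr (F.known.A c y) I) (by fun_prop) (D.smooth_ΔΓ I)
    (fun z hz => D.repr_Δ_add hz I) hy 0
  have e1 : pd 1 (fun z => ε.repr (F.Δ ε z) I) (emb y) =
      pd 0 (fun z => ε.repr (F.Δ ε (emb z)) I) y := D.pd_succ_eq hΔ hy 0
  have e2 : ∀ b, pd 1 (F.Γ b) (emb y) = pd 0 (fun z => F.Γ b (emb z)) y := fun b =>
    D.pd_succ_eq (hΓ b) hy 0
  -- Γ¹ vanishes along `S`, so the term Γ¹_{,2}A₁ drops out as well.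
  have e3 : pd 0 (fun z => F.Γ 0 (emb z)) y = 0 := by
    rw [D.pd_eqOn (hΓ3 0) (contDiffOn_const (c := 0)) (fun z hz => D.Γ_zero hz) hy, pd_const]
  have e4 : ∀ a, F.g (gk a) 1 (emb y) = 0 := fun a => (D.symm hy _ _).trans (D.g1a a y hy)
  have e5 : F.g 0 1 (emb y) = F.known.g12 y := rfl
  have e6 : ∀ a, F.A (gk a) (emb y) = F.known.A a y := fun _ => rfl
  simp only [Fin.sum_univ_two] at h1 h2
  simp (disch := fun_prop) only [pd_add, pd_mul] at h2
  simp only [Fields.combA, Fields.LA, D.gInv_zero_one hy, D.pd_one_g01 hy, sum_fin_four,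
    D.g11 y hy, e4, e5, e6, D.pdL_one_A1 hy, D.pdL_one_Aa hy, D.A1 y hy, D.Γ_zero hy, e2, e3,
    Fin.sum_univ_two]
  simp only [map_smul, map_add, map_sub, map_zero, Finsupp.smul_apply, Finsupp.add_apply,
    Finsupp.sub_apply, Finsupp.zero_apply, smul_eq_mul, repr_pdL, e1]
  linear_combination -h2 - 2 * (F.known.n y * pd 0 F.known.g12 y) * h1

end CharData

/-! ### The second combination. -/

namespace CharData

variable {𝔤 : Type*} [LieRing 𝔤] [LieAlgebra ℝ 𝔤] {N : ℕ} {F : Fields 𝔤}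
  {ε : Module.Basis (Fin N) ℝ 𝔤} {U : Set (Sp 4)} {S : Set (Sp 3)} {y : Sp 3}

lemma smooth_t (D : CharData F ε U S) (l : Fin 2) : ContDiffOn ℝ ∞ (F.known.t l) (F.dom U) := by
  have hu := D.smooth_u
  have hdq := fun a b i => D.pd_dom (D.smooth_q a b) i
  unfold Known.t
  fun_prop

lemma smooth_tr2 (D : CharData F ε U S) : ContDiffOn ℝ ∞ F.known.tr2 (F.dom U) := by
  have hu := D.smooth_u
  have hdq := fun a b i => D.pd_dom (D.smooth_q a b) i
  unfold Known.tr2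
  fun_prop

/-- The second combination, on `S`. -/
theorem combA_eq (D : CharData F ε U S) (hy : y ∈ S) :
    F.combA ε (emb y) = F.known.rhsA ε F.unkA F.unkG y := by
  refine ext_repr ε fun I => ?_
  have hsy := D.subset_dom hy
  have hf := ContDiffOn.diffAt D.smooth_g12 D.isOpen_dom hsy
  have hn := ContDiffOn.diffAt D.smooth_n D.isOpen_dom hsy
  have hu := fun a b => ContDiffOn.diffAt (D.smooth_u a b) D.isOpen_dom hsy
  have hz := fun b => ContDiffOn.diffAt (D.smooth_z b) D.isOpen_dom hsy
  have hsA := ContDiffOn.diffAt (D.smooth_sA I) D.isOpen_dom hsy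
  have ht := fun b => ContDiffOn.diffAt (D.smooth_t b) D.isOpen_dom hsy
  have htr := ContDiffOn.diffAt D.smooth_tr2 D.isOpen_dom hsy
  have hA := fun a => ContDiffOn.diffAt (D.smooth_A a I) D.isOpen_dom hsy
  have hdA := fun a i => ContDiffOn.diffAt (D.pd_dom (D.smooth_A a I) i) D.isOpen_dom hsy
  have hdX := fun i => ContDiffOn.diffAt (D.pd_dom (D.smooth_unkA I) i) D.isOpen_dom hsy
  have hdf := fun i => ContDiffOn.diffAt (D.pd_dom D.smooth_g12 i) D.isOpen_dom hsy
  have hcf : ∀ a, pd 0 (pd (gs a) F.known.g12) y = pd (gs a) (pd 0 F.known.g12) y := fun a =>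
    pd_comm _ _ D.smooth_g12 D.isOpen_dom hsy
  have hcA : ∀ a b, pd 0 (pd (gs a) fun z => ε.repr (F.known.A b z) I) y =
      pd (gs a) (pd 0 fun z => ε.repr (F.known.A b z) I) y := fun a b =>
    pd_comm _ _ (D.smooth_A b I) D.isOpen_dom hsy
  have hn0 : F.known.n y ≠ 0 := inv_ne_zero hsy.2.1
  -- Writing g₁₂ as n⁻¹ leaves a single scalar to be cleared from denominators.
  have hfn : F.known.g12 y = (F.known.n y)⁻¹ := (inv_inv _).symm
  rw [D.repr_combA hy, D.repr_divCurv hy]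
  simp only [Known.rhsA, Known.kA, Known.aG, Known.w₂, Known.g122, Fin.sum_univ_two]
  unfold Fields.E1 Fields.Ek Fields.ΔΓ
  simp only [Known.w, map_smul, map_add, map_sub, map_neg, Finsupp.smul_apply, Finsupp.add_apply,
    Finsupp.sub_apply, Finsupp.neg_apply, smul_eq_mul, repr_pdL, Fin.sum_univ_two]
  simp (disch := fun_prop) only [pd_add, pd_sub, pd_mul, pd_neg, pd_const, pow_two]
  simp only [hcf, hcA, D.pd_n _ hsy, D.pd_u _ _ _ hsy, Fin.sum_univ_two, hfn]
  simp only [D.u_symm 1 0 hsy, fun i => D.pd_q_symm i 1 0 hsy]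
  -- A_{2,1} cancels here: it enters g₁₂∇̂_iF^{i1} through F^{21} with the factor n², and D with the
  -- factor n. The same cancellation turns the two copies of A_{1,22} into −2n A_{1,22}.
  field_simp
  ring

end CharData

/-! ### Sources and the equivalence with the linear system. -/

namespace CharData

variable {𝔤 : Type*} [LieRing 𝔤] [LieAlgebra ℝ 𝔤] {N : ℕ} {F : Fields 𝔤}
  {ε : Module.Basis (Fin N) ℝ 𝔤} {U : Set (Sp 4)} {S : Set (Sp 3)} {y : Sp 3}

/-- Only J¹ = n[Φ, ∇̂₂Φ] contributes to J₂ = g₁₂J¹, the factors cancel, and A₂ = 0 reduces ∇̂₂Φ to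
Φ_{,2}. -/
lemma J_one (D : CharData F ε U S) (hy : y ∈ S) : F.J ε 1 (emb y) = F.known.j2 ε y := by
  have hp := D.sub y hy
  have hn : F.known.n y * F.known.g12 y = 1 := n_mul_g12 (D.subset_dom hy)
  have e0 : F.g 1 0 (emb y) = F.known.g12 y := D.symm hy 1 0
  have e1 : F.dHiggs ε 1 (emb y) = pdL ε 0 F.known.Φ y := by
    simp [Fields.dHiggs, D.pdL_one_Φ hy, D.A1 y hy]
  simp only [Fields.J, Fields.currentUp, sum_fin_four, D.g11 y hy, D.g1a _ y hy, e0, e1,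
    D.gInv_zero_zero hy, D.gInv_zero_one hy, D.gInv_zero_gk hy, Known.j2, Fin.sum_univ_two,
    zero_smul, zero_add, add_zero, lie_smul, smul_smul]
  rw [mul_comm, hn, one_smul]
  rfl

/-- The components `τ_{2α}` of the energy tensor on `S`. -/
lemma τ_one (D : CharData F ε U S) (B : LinearMap.BilinForm ℝ 𝔤) (hB : B.IsSymm) (V : ℝ → ℝ)
    (hy : y ∈ S) (a : Fin 2) :
    F.τ ε B V 1 (gk a) (emb y) =
      -(F.known.n y * B (pdL ε 0 (F.known.A a) y) (pdL ε 0 F.unkA y - pdL ε 0 (F.A 1) (emb y)))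
      + F.known.n y * ∑ c, ∑ b, F.known.u c b y * F.unkG b y *
        B (pdL ε 0 (F.known.A a) y) (pdL ε 0 (F.known.A c) y)
      - ∑ b, ∑ l, F.known.u b l y * B (pdL ε (gs l) (F.known.A a) y
        - pdL ε (gs a) (F.known.A l) y + ⁅F.known.A l y, F.known.A a y⁆) (pdL ε 0 (F.known.A b) y)
      + B (pdL ε 0 F.known.Φ y) (pdL ε (gs a) F.known.Φ y + ⁅F.known.A a y, F.known.Φ y⁆) := by
  have e1 : F.dHiggs ε 1 (emb y) = pdL ε 0 F.known.Φ y := by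
    simp [Fields.dHiggs, D.pdL_one_Φ hy, D.A1 y hy]
  have e2 : F.dHiggs ε (gk a) (emb y) = pdL ε (gs a) F.known.Φ y
      + ⁅F.known.A a y, F.known.Φ y⁆ := by
    simp only [Fields.dHiggs, D.pdL_gk_Φ hy]
    rfl
  have c10 : F.curv ε 1 0 (emb y) = pdL ε 0 F.unkA y - pdL ε 0 (F.A 1) (emb y) := by
    rw [F.curv_antisymm ε, D.curv_01 hy, neg_sub]
  have c1a : ∀ a, F.curv ε 1 (gk a) (emb y) = pdL ε 0 (F.known.A a) y := fun a => by
    rw [F.curv_antisymm ε, D.curv_a1 hy, neg_neg]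
  have cab : ∀ l, F.curv ε (gk a) (gk l) (emb y) = -(pdL ε (gs l) (F.known.A a) y
        - pdL ε (gs a) (F.known.A l) y + ⁅F.known.A l y, F.known.A a y⁆) := fun l => by
    rw [F.curv_antisymm ε, D.curv_ab hy]
  have hs : ∀ v w : 𝔤, B v w = B w v := fun v w => by simpa using hB.eq v w
  have hs1 := fun c => hs (pdL ε 0 (F.known.A c) y) (pdL ε 0 (F.known.A a) y)
  have hs2 := fun c l => hs (pdL ε 0 (F.known.A c) y) (pdL ε (gs l) (F.known.A a) y
        - pdL ε (gs a) (F.known.A l) y + ⁅F.known.A l y, F.known.A a y⁆)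
  -- Since g_{2α} = 0, the trace term and the potential `V` disappear.
  simp only [Fields.τ, D.g1a a y hy, e1, e2, mul_zero, zero_mul, sub_zero, add_zero]
  simp only [sum_fin_four, c10, c1a, cab, D.curv_11 hy, D.curv_a1 hy, D.gInv_zero_zero hy,
    D.gInv_zero_one hy, D.gInv_zero_gk hy, D.gInv_gk_zero hy, D.gInv_gk_one hy, D.gInv_gk_gk hy,
    Fin.sum_univ_two, zero_smul, zero_add, add_zero]
  have hz : ∀ v, B 0 v = 0 := fun v => by rw [map_zero, LinearMap.zero_apply]
  have ha : ∀ u v w, B u (v + w) = B u v + B u w := fun u => map_add (B u)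
  have hm : ∀ (c : ℝ) u v, B u (c • v) = c * B u v := fun c u v => map_smul (B u) c v
  have hg : ∀ u v, B u (-v) = -B u v := fun u => map_neg (B u)
  simp only [← hs2]
  simp only [ha, hm, hg, hz]
  rw [hs (pdL ε 0 F.unkA y - pdL ε 0 (F.A 1) (emb y))]
  simp only [hs1]
  ring

/-- The modified reduced equations on `S` are a linear second order system for `A₁` and
`g_{1α}`. -/
theorem modifiedReduced_iff (D : CharData F ε U S) (B : LinearMap.BilinForm ℝ 𝔤)
    (hB : B.IsSymm) (V : ℝ → ℝ) (hy : y ∈ S) :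
    F.ModifiedReduced ε B V (emb y) ↔ F.known.LinearODE ε B F.unkA F.unkG y := by
  have hs : ∀ v w : 𝔤, B v w = B w v := fun v w => by simpa using hB.eq v w
  have e6 : ∀ a, F.A (gk a) (emb y) = F.known.A a y := fun _ => rfl
  refine and_congr (forall_congr' fun a => ?_) ?_
  · have h := congrArg (B (pdL ε 0 (F.known.A a) y)) (D.Δ_add hy)
    have ha : ∀ u v w, B u (v + w) = B u v + B u w := fun u => map_add (B u)
    have hb : ∀ u v w, B u (v - w) = B u v - B u w := fun u => map_sub (B u)
    have hm : ∀ (c : ℝ) u v, B u (c • v) = c * B u v := fun c u v => map_smul (B u) c v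
    have hm' : ∀ (c : ℝ) u v, B (c • u) v = c * B u v := fun c u v => by
      rw [hs, hm, hs]
    have hτ := D.τ_one B hB V hy a
    have hs1 := fun c => hs (F.known.A c y) (pdL ε 0 (F.known.A a) y)
    rw [← sub_eq_zero, ← sub_eq_zero (b := (0 : ℝ)), D.combR_eq hy]
    refine Eq.congr ?_ rfl
    rw [hτ]
    simp only [D.pdL_one_Aa hy, e6, hs1, Known.rhsR, Known.κ, Known.χ, Known.dig, Known.ϰ, hm',
      Fin.sum_univ_two] at h ⊢
    simp only [ha, hb, hm] at h ⊢
    have hδ : ∀ l, (if a = l then F.known.n y ^ 2 * F.known.g122 y else 0) =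
      (if a = l then 1 else 0) * (F.known.n y ^ 2 * F.known.g122 y) := fun l => by
      split_ifs <;> ring
    have hz : pd 0 (F.unkG a) y = (if a = 0 then 1 else 0) * pd 0 (F.unkG 0) y
        + (if a = 1 then 1 else 0) * pd 0 (F.unkG 1) y := by
      fin_cases a <;> simp
    rw [hδ, hδ]
    -- `h` supplies n A_{α,2}.(A_{1,2} + A_{2,1}) against the term from τ_{2α}, which produces ϰ_α;
    -- `hz` expands the Kronecker delta in κ_α^λ.
    linear_combination h + F.known.n y ^ 2 * F.known.g122 y * hz
  · rw [D.combA_eq hy, D.J_one hy, ← sub_eq_zero]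
    refine Eq.congr ?_ rfl
    simp only [Known.rhsA, Known.bA, Fin.sum_univ_two]
    module

end CharData

/-- The conditions of the stage under consideration determine characteristic data. -/
lemma Fields.Stage.charData {𝔤 : Type*} [LieRing 𝔤] [LieAlgebra ℝ 𝔤] {N : ℕ} {F : Fields 𝔤}
    {ε : Module.Basis (Fin N) ℝ 𝔤} {U : Set (Sp 4)} {S : Set (Sp 3)} {Ω : Sp 3 → ℝ}
    {h : Fin 2 → Fin 2 → Sp 3 → ℝ} (hF : F.RegularOn ε U) (hU : IsOpen U)
    (hSU : ∀ y ∈ S, emb y ∈ U) (hS : S ⊆ closure (interior S))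
    (hΩ : ContDiffOn ℝ ∞ Ω (emb ⁻¹' U)) (hst : F.Stage S Ω h) : CharData F ε U S := by
  have hV : IsOpen (emb ⁻¹' U) := hU.preimage contDiff_emb.continuous
  have hq : ∀ a b, ContDiffOn ℝ ∞ (F.known.q a b) (emb ⁻¹' U) := fun a b =>
    (hF.smooth_g _ _).comp contDiff_emb.contDiffOn fun _ hy => hy
  -- Only det(g_{αβ}) = Ω² will be differentiated, so no smoothness of `h` is required.
  have hdet : ∀ y ∈ S, F.known.q 0 0 y * F.known.q 1 1 y - F.known.q 0 1 y * F.known.q 1 0 y =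
      Ω y * Ω y := by
    intro y hy
    have h1 := hst.det_h y hy
    have hc : ∀ a b, F.known.q a b y = Ω y * h a b y := fun a b => hst.conf a b y hy
    simp only [Matrix.det_fin_two, Matrix.of_apply] at h1
    simp only [hc]
    linear_combination Ω y ^ 2 * h1
  have hdet' : ∀ y ∈ S, (Matrix.of fun a b => F.known.q a b y).det ≠ 0 := by
    intro y hy
    rw [Matrix.det_fin_two]
    simp only [Matrix.of_apply]
    rw [hdet y hy]
    exact mul_self_ne_zero.mpr (hst.Ω_pos y hy).ne'
  refine ⟨hU, hF, hSU, hS, hst.g22, hst.g2a, hst.A2, hdet', fun y hy => ?_, hst.g221⟩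
  have hyV : y ∈ emb ⁻¹' U := hSU y hy
  have hqd := fun a b => ContDiffOn.diffAt (hq a b) hV hyV
  have hΩd := ContDiffOn.diffAt hΩ hV hyV
  -- By Jacobi's formula the x²-derivative of det(g_{αβ}) = Ω² is g^{αβ}g_{αβ,2} = 2Ω_{,2}/Ω;
  -- combined with the condition on g_{12,2} it gives the trace condition.
  have hp := pd_eq_of_eqOn (f := fun y => F.known.q 0 0 y * F.known.q 1 1 y
    - F.known.q 0 1 y * F.known.q 1 0 y) hV hSU hS (by fun_prop) (hΩ.mul hΩ) hdet 0 hy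
  simp (disch := fun_prop) only [pd_sub, pd_mul] at hp
  have hΩ0 := (hst.Ω_pos y hy).ne'
  have hg : F.known.g122 y = 1 / 2 * F.known.g12 y * (pd 0 Ω y / Ω y) := by
    refine Eq.trans ?_ (hst.g12 y hy)
    exact pd_comp_emb (f := F.g 0 1) 0 (ContDiffOn.diffAt (hF.smooth_g 0 1) hU (hSU y hy))
  have hdy := hdet y hy
  have hu : ∀ a b, F.known.u a b y = (Ω y * Ω y)⁻¹ *
      (Matrix.of fun c d => F.known.q c d y).adjugate a b := by
    intro a b
    simp only [Known.u, Matrix.inv_def, Ring.inverse_eq_inv', Matrix.smul_apply, smul_eq_mul,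
      Matrix.det_fin_two, Matrix.of_apply]
    rw [hdy]
  have hsm : ∀ a b, pd 0 (F.known.q a b) y = pd 0 (F.known.q b a) y := fun a b =>
    pd_congr_on 0 hV (fun z hz => hF.symm _ _ _ hz) hyV
  have hsm' : F.known.q 1 0 y = F.known.q 0 1 y := hF.symm _ _ _ hyV
  rw [hg]
  simp only [Known.tr2, hu, Matrix.adjugate_fin_two, Matrix.of_apply, Fin.sum_univ_two,
    Matrix.cons_val_zero, Matrix.cons_val_one, hsm 1 0, hsm'] at hp ⊢
  field_simp
  linear_combination -2 * F.known.g12 y * hp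

end EYMH

end

theorem proposition3p7 {𝔤 : Type*} [LieRing 𝔤] [LieAlgebra ℝ 𝔤] {N : ℕ}
    (ε : Module.Basis (Fin N) ℝ 𝔤)
    (B : LinearMap.BilinForm ℝ 𝔤) (hB_symm : B.IsSymm) (hB_nondeg : B.Nondegenerate)
    (hB_inv : ∀ f k l : 𝔤, B f ⁅k, l⁆ = B ⁅f, k⁆ l)
    (V : ℝ → ℝ) (hV : ContDiff ℝ ∞ V)
    (L : Set (EYMH.Sp 4)) (T₁ : ℝ)
    (hG : EYMH.slice L T₁ ⊆ closure (interior (EYMH.slice L T₁)))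
    (U : Set (EYMH.Sp 4)) (hU : IsOpen U) (hGU : EYMH.G1 L T₁ ⊆ U)
    (F : EYMH.Fields 𝔤) (hF : F.RegularOn ε U)
    (Ω : EYMH.Sp 3 → ℝ) (h : Fin 2 → Fin 2 → EYMH.Sp 3 → ℝ)
    (hΩ : ContDiffOn ℝ ∞ Ω (EYMH.emb ⁻¹' U))
    (hS : F.Stage (EYMH.slice L T₁) Ω h) :
    (∀ y ∈ EYMH.slice L T₁,
      (∀ a : Fin 2, F.combR a (EYMH.emb y) = F.known.rhsR F.unkG a y) ∧
      F.combA ε (EYMH.emb y) = F.known.rhsA ε F.unkA F.unkG y) ∧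
    (∀ y ∈ EYMH.slice L T₁,
      F.ModifiedReduced ε B V (EYMH.emb y) ↔ F.known.LinearODE ε B F.unkA F.unkG y) := by
  have D := hS.charData hF hU (fun y hy => hGU hy) hG hΩ
  exact ⟨fun y hy => ⟨fun a => D.combR_eq hy a, D.combA_eq hy⟩,
    fun y hy => D.modifiedReduced_iff B hB_symm V hy⟩
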